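/- **Setting.** Let $D$ be a probability distribution of pairs $(x,\ell)\in\mathcal X\times\mathbb R^K$ with $\ell\in[0,1]^K$ almost surely, and let $\Pi$ be a finite non-empty class of (measurable) policies $\pi:\mathcal X\to\{1,\dots,K\}$. Put $L(\pi)=\mathbb E_{(x,\ell)\sim D}[\ell(\pi(x))]$, let $\pi^*\in\Pi$ minimize $L$, let $P_x$ be the marginal of $D$ on contexts, $\rho(\pi,\pi')=P_x(\pi(x)\neq\pi'(x))$, $\mathrm{DIS}(r)=\{x:\exists\pi\in\Pi,\ \rho(\pi,\pi^*)\le r,\ \pi(x)\ne\pi^*(x)\}$ and $\theta=\sup_{r>0}P_x(\mathrm{DIS}(r))/r$. Let $0<\epsilon\le1$, $0<\delta<1$, $\delta_T=\delta/(T^2+T)$, $e_T=\log(2|\Pi|/\delta_T)/T$ for $T\ge1$, and for $t\ge2$ $$\Delta_t=\Big(\sqrt{2K/\epsilon}+1\Big)\sqrt{e_{t-1}}+\Big(K/\epsilon+3\Big)e_{t-1},\qquad \Delta_1=\infty .$$ For a finite sample $Z$ of pairs $(x,c)$ (counted with multiplicity) let $L(\pi,Z)=|Z|^{-1}\sum_{(x,c)\in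 Z}c(\pi(x))$, and $L(\pi,\emptyset)=0$. **Algorithm (active $\epsilon$-greedy).** Start from $\hat Z_0=\emptyset$. In round $t\ge1$, a pair $(x_t,\ell_t)\sim D$ is drawn independently of the past. Let $\pi_t\in\arg\min_{\pi\in\Pi}L(\pi,\hat Z_{t-1})$ (ties broken as a function of the past rounds), $\pi_{t,a}\in\arg\min_{\pi\in\Pi:\pi(x_t)=a}L(\pi,\hat Z_{t-1})$ for each action $a$ chosen at $x_t$ by some policy of $\Pi$, and let $A_t$ be the set of those $a$ with $L(\pi_{t,a},\hat Z_{t-1})-L(\pi_t,\hat Z_{t-1})\le\Delta_t$. Given the past and $(x_t,\ell_t)$, the action $a_t$ is drawn from $p_t$, where $p_t(\pi_t(x_t))=1-(|A_t|-1)\epsilon/K$, $p_t(a)=\epsilon/K$ for $a\in A_t\setminus\{\pi_t(x_t)\}$, and $p_t(a)=0$ otherwise. The pair $(x_t,\hat\ell_t)$ is added to the sample, giving $\hat Z_t$, where $\hat\ell_t(a)=\mathbf 1\{a=a_t\}\,\ell_t(a_t)/p_t(a_t)$ if $a\in A_t$ and $\hat\ell_t(a)=1$ otherwise. Let also $\tilde\ell_t(a)=\ell_t(a)$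 if $a\in A_t$ and $\tilde\ell_t(a)=1$ otherwise, and let $\hat L_T,\tilde L_T,L_T$ be the empirical losses on $(x_t,\hat\ell_t)_{t\le T}$, $(x_t,\tilde\ell_t)_{t\le T}$, $(x_t,\ell_t)_{t\le T}$. Write $\mathcal F_t=\sigma(x_i,\ell_i,a_i:i\le t)$, $r_t=\ell_t(a_t)-\ell_t(\pi^*(x_t))$ and $R_T=\sum_{t=1}^Tr_t$. **Event.** For $n\ge0$ let $\mathcal E_n$ be the event that, for all $1\le T\le n$ and all $\pi\in\Pi$, $$\big|(\hat L_T(\pi)-\hat L_T(\pi^*))-(\tilde L_T(\pi)-\tilde L_T(\pi^*))\big|\le\sqrt{\tfrac{2K\rho(\pi,\pi^*)e_T}{\epsilon}}+\Big(\tfrac K\epsilon+1\Big)e_T,$$ $$\big|(L_T(\pi)-L_T(\pi^*))-(L(\pi)-L(\pi^*))\big|\le\sqrt{\rho(\pi,\pi^*)e_T}+2e_T,$$ and let $\mathcal E=\bigcap_n\mathcal E_n$. **Proposition.** Assume that, for some $\tau>0$, $L(\pi)-L(\pi^*)\ge\tau$ for all $\pi\in\Pi$ with $\pi\ne\pi^*$,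 and that $\theta<\infty$. Then $T_0:=\max\{t\ge1:2\Delta_t\ge\tau\}$ exists, and with $B:=1+\sum_{t=2}^{T_0}(\Delta_t+\epsilon)$ the following hold. 1. Almost surely on $\mathcal E$, for every $t>T_0$: $a_t=\pi^*(x_t)$ and $r_t=0$ (the algorithm stops incurring regret), and $\mathbb E[r_t\mid\mathcal F_{t-1}]=0$. 2. Almost surely on $\mathcal E$, $\sum_{t=1}^T\mathbb E[r_t\mid\mathcal F_{t-1}]\le B$ for every $T$. 3. For every $T$, $R_T$ is integrable and $\mathbb E\big[\sum_{t=1}^T r_t\,\mathbf 1_{\mathcal E_{t-1}}\big]\le B$ (the sum equals $R_T$ on $\mathcal E$). 4. If $P(\mathcal E)>0$, then for every $T$, $\mathbb E[R_T\mid\mathcal E]\le T_0$ and $\mathbb E[R_T\mid\mathcal E]\le B+(B+T_0)\,P(\mathcal E^c)/P(\mathcal E)$; so the conditional expected regret is bounded by a constant independent of $T$. -/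

import Mathlib

open MeasureTheory ProbabilityTheory

namespace ActiveGreedy

/-- A (deterministic) policy: a map from contexts to the `K` actions. -/
abbrev Policy (X : Type*) (K : ℕ) := X → Fin K

/-- A finite sample of cost-sensitive examples `(x, c)`, kept as a list, so that repeated examples
are counted with multiplicity. -/
abbrev Sample (X : Type*) (K : ℕ) := List (X × (Fin K → ℝ))

section Population

variable {X : Type*} [MeasurableSpace X] {K : ℕ}

/-- Expected loss `L(π) = E_{(x,ℓ) ∼ D} [ℓ(π(x))]`. -/
noncomputable def expLoss (D : Measure (X × (Fin K → ℝ))) (π : Policy X K) : ℝ :=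
  ∫ z, z.2 (π z.1) ∂D

/-- Expected disagreement `ρ(π, π') = P_x(π(x) ≠ π'(x))`, with `P_x` the context marginal of `D`. -/
noncomputable def rho (D : Measure (X × (Fin K → ℝ))) (π π' : Policy X K) : ℝ :=
  D.fst.real {x | π x ≠ π' x}

/-- `πs` minimizes the expected loss over the policy class. -/
def IsOptimal (D : Measure (X × (Fin K → ℝ))) (Pol : Finset (Policy X K)) (πs : Policy X K) :
    Prop :=
  πs ∈ Pol ∧ ∀ π ∈ Pol, expLoss D πs ≤ expLoss D π

/-- Disagreement region `DIS(r)` of the ball `B(πs, r) = {π ∈ Π : ρ(π, πs) ≤ r}`. -/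
def disRegion (D : Measure (X × (Fin K → ℝ))) (Pol : Finset (Policy X K)) (πs : Policy X K)
    (r : ℝ) : Set X :=
  {x | ∃ π ∈ Pol, rho D π πs ≤ r ∧ π x ≠ πs x}

/-- Disagreement coefficient `θ = sup_{r > 0} P_x(DIS(r)) / r`, as an extended real. -/
noncomputable def disCoeff (D : Measure (X × (Fin K → ℝ))) (Pol : Finset (Policy X K))
    (πs : Policy X K) : ENNReal :=
  ⨆ (r : ℝ) (_ : 0 < r), D.fst (disRegion D Pol πs r) / ENNReal.ofReal r

end Population

/-- `e_T = log(2N / δ_T) / T` with `δ_T = δ / (T² + T)`, where `N` is the number of policies. -/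
noncomputable def errRate (N : ℕ) (δ : ℝ) (T : ℕ) : ℝ :=
  Real.log (2 * N / (δ / ((T : ℝ) ^ 2 + T))) / T

/-- Threshold `Δ_T = (√(2K/ε) + 1) √e_{T-1} + (K/ε + 3) e_{T-1}`, meant for `T ≥ 2`.
For `T = 1` the value is irrelevant as long as it is nonnegative (here it is `0`): the sample
used in the first round is empty and all empirical losses vanish. -/
noncomputable def threshold (K N : ℕ) (ε δ : ℝ) (T : ℕ) : ℝ :=
  (Real.sqrt (2 * K / ε) + 1) * Real.sqrt (errRate N δ (T - 1))
    + (K / ε + 3) * errRate N δ (T - 1)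

/-- Rounds at which the threshold is still too large for the gap `τ`; the first round, in which
nothing has been observed (`Δ_1 = ∞`), always belongs to them. -/
def unresolvedRounds (K N : ℕ) (ε δ τ : ℝ) : Set ℕ :=
  {t | t = 1 ∨ (2 ≤ t ∧ τ ≤ 2 * threshold K N ε δ t)}

/-- `T_0 = max {t : 2 Δ_t ≥ τ}`. -/
noncomputable def lastRound (K N : ℕ) (ε δ τ : ℝ) : ℕ :=
  sSup (unresolvedRounds K N ε δ τ)

/-- The constant `1 + ∑_{t=2}^{T_0} (Δ_t + ε)`. -/
noncomputable def regretBound (K N : ℕ) (ε δ τ : ℝ) : ℝ :=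
  1 + ∑ t ∈ Finset.Icc 2 (lastRound K N ε δ τ), (threshold K N ε δ t + ε)

section Algorithm

variable {X : Type*} {K : ℕ}

/-- Empirical loss `L(π, Z) = |Z|⁻¹ ∑_{(x,c) ∈ Z} c(π(x))` (`0` on the empty sample). -/
noncomputable def empLoss (Z : Sample X K) (π : Policy X K) : ℝ :=
  (Z.map fun z => z.2 (π z.1)).sum / Z.length

/-- `π` is an output of the cost-sensitive classification oracle on the sample `Z` over the
policies in `S`. -/
def IsArgmin (S : Set (Policy X K)) (Z : Sample X K) (π : Policy X K) : Prop :=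
  π ∈ S ∧ ∀ π' ∈ S, empLoss Z π ≤ empLoss Z π'

open Classical in
/-- The explored actions: those `a` for which the best policy `π_a` on `Z` among the policies
choosing `a` at `x` satisfies `L(π_a, Z) - L(πt, Z) ≤ Δ`; an action chosen by no policy of
the class at `x` is not explored. -/
noncomputable def exploreSet (Pol : Finset (Policy X K)) (Δ : ℝ) (Z : Sample X K)
    (πt : Policy X K) (x : X) : Finset (Fin K) :=
  Finset.univ.filter fun a =>
    ∃ πa, IsArgmin {π | π ∈ Pol ∧ π x = a} Z πa ∧ empLoss Z πa - empLoss Z πt ≤ Δ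

/-- Probability of playing `a`, given the explored set `A` and the greedy action `g`. -/
noncomputable def actionProb (ε : ℝ) (A : Finset (Fin K)) (g a : Fin K) : ℝ :=
  if a = g then 1 - ((A.card : ℝ) - 1) * ε / K else if a ∈ A then ε / K else 0

/-- Biased loss vector: the true loss on explored actions, `1` elsewhere. -/
def tildeLoss (A : Finset (Fin K)) (ℓ : Fin K → ℝ) : Fin K → ℝ :=
  fun a => if a ∈ A then ℓ a else 1

/-- Inverse-propensity estimate of the biased loss vector; `act` is the played action and `p` its
probability. -/
noncomputable def hatLoss (A : Finset (Fin K)) (p : ℝ) (act : Fin K) (ℓ : Fin K → ℝ) :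
    Fin K → ℝ :=
  fun a => if a ∈ A then (if a = act then 1 else 0) / p * ℓ act else 1

/-- The sample `Ẑ_t` built by the algorithm along one trajectory: contexts `x`, losses `ℓ`,
played actions `act` and oracle policies `pol` (rounds are numbered from `1`). -/
noncomputable def hatSample (Pol : Finset (Policy X K)) (ε δ : ℝ) (x : ℕ → X)
    (ℓ : ℕ → Fin K → ℝ) (act : ℕ → Fin K) (pol : ℕ → Policy X K) : ℕ → Sample X K
  | 0 => []
  | t + 1 =>
    let Z := hatSample Pol ε δ x ℓ act pol t
    let A := exploreSet Pol (threshold K Pol.card ε δ (t + 1)) Z (pol (t + 1)) (x (t + 1))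
    let p := actionProb ε A (pol (t + 1) (x (t + 1))) (act (t + 1))
    (x (t + 1), hatLoss A p (act (t + 1)) (ℓ (t + 1))) :: Z

/-- The set `A_t` explored in round `t ≥ 1` along a trajectory. -/
noncomputable def exploredAt (Pol : Finset (Policy X K)) (ε δ : ℝ) (x : ℕ → X)
    (ℓ : ℕ → Fin K → ℝ) (act : ℕ → Fin K) (pol : ℕ → Policy X K) (t : ℕ) : Finset (Fin K) :=
  exploreSet Pol (threshold K Pol.card ε δ t) (hatSample Pol ε δ x ℓ act pol (t - 1)) (pol t) (x t)

/-- The probability `p_t(a)` used in round `t ≥ 1` along a trajectory. -/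
noncomputable def probAt (Pol : Finset (Policy X K)) (ε δ : ℝ) (x : ℕ → X)
    (ℓ : ℕ → Fin K → ℝ) (act : ℕ → Fin K) (pol : ℕ → Policy X K) (t : ℕ) (a : Fin K) : ℝ :=
  actionProb ε (exploredAt Pol ε δ x ℓ act pol t) (pol t (x t)) a

/-- The biased sample `Z̃_T`. -/
noncomputable def tildeSample (Pol : Finset (Policy X K)) (ε δ : ℝ) (x : ℕ → X)
    (ℓ : ℕ → Fin K → ℝ) (act : ℕ → Fin K) (pol : ℕ → Policy X K) (T : ℕ) : Sample X K :=
  (List.range T).map fun i =>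
    (x (i + 1), tildeLoss (exploredAt Pol ε δ x ℓ act pol (i + 1)) (ℓ (i + 1)))

/-- The full-information sample `Z_T`. -/
def fullSample (x : ℕ → X) (ℓ : ℕ → Fin K → ℝ) (T : ℕ) : Sample X K :=
  (List.range T).map fun i => (x (i + 1), ℓ (i + 1))

end Algorithm

section Runs

variable {X : Type*} [MeasurableSpace X] {K : ℕ} {Ω : Type*}

/-- `F_t = σ(x_i, ℓ_i, a_i : 1 ≤ i ≤ t)`. -/
@[reducible] def history (x : ℕ → Ω → X) (ℓ : ℕ → Ω → Fin K → ℝ) (act : ℕ → Ω → Fin K) (t : ℕ) :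
    MeasurableSpace Ω :=
  ⨆ i ∈ Finset.Icc 1 t,
    MeasurableSpace.comap (fun ω => (x i ω, ℓ i ω, act i ω)) inferInstance

/-- `(x_t, ℓ_t, a_t, π_t)_{t ≥ 1}` is a run of active ε-greedy with thresholds `Δ_t` on i.i.d. data
drawn from `D`. -/
structure IsRun [MeasurableSpace Ω] (μ : Measure Ω) (D : Measure (X × (Fin K → ℝ)))
    (Pol : Finset (Policy X K)) (ε δ : ℝ) (x : ℕ → Ω → X) (ℓ : ℕ → Ω → Fin K → ℝ)
    (act : ℕ → Ω → Fin K) (pol : ℕ → Ω → Policy X K) : Prop where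
  measurable_x : ∀ t, Measurable (x t)
  measurable_loss : ∀ t, Measurable (ℓ t)
  measurable_act : ∀ t, Measurable (act t)
  /-- `(x_t, ℓ_t)` has law `D` ... -/
  law : ∀ t, μ.map (fun ω => (x (t + 1) ω, ℓ (t + 1) ω)) = D
  /-- ... and is independent of the past. -/
  indep : ∀ t, Indep
    (MeasurableSpace.comap (fun ω => (x (t + 1) ω, ℓ (t + 1) ω)) inferInstance)
    (history x ℓ act t) μ
  /-- The policy `π_t` is an output of the oracle on the sample of the previous rounds ... -/
  pol_argmin : ∀ t ω, IsArgmin (Pol : Set (Policy X K))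
    (hatSample Pol ε δ (fun i => x i ω) (fun i => ℓ i ω) (fun i => act i ω) (fun i => pol i ω) t)
    (pol (t + 1) ω)
  /-- ... and ties are broken as a function of the past. -/
  pol_past : ∀ t, ∀ π ∈ Pol, MeasurableSet[history x ℓ act t] {ω | pol (t + 1) ω = π}
  /-- The action is drawn from `p_t`, given the past and `(x_t, ℓ_t)`. -/
  act_law : ∀ t a,
    μ[Set.indicator {ω | act (t + 1) ω = a} (fun _ => (1 : ℝ)) | history x ℓ act t ⊔
        MeasurableSpace.comap (fun ω => (x (t + 1) ω, ℓ (t + 1) ω)) inferInstance]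
      =ᵐ[μ] fun ω => probAt Pol ε δ (fun i => x i ω) (fun i => ℓ i ω) (fun i => act i ω)
        (fun i => pol i ω) (t + 1) a

/-- The two deviation bounds at time `T`, for all policies of the class, at the outcome `ω`. -/
def DeviationAt (D : Measure (X × (Fin K → ℝ))) (Pol : Finset (Policy X K)) (πs : Policy X K)
    (ε δ : ℝ) (x : ℕ → Ω → X) (ℓ : ℕ → Ω → Fin K → ℝ) (act : ℕ → Ω → Fin K)
    (pol : ℕ → Ω → Policy X K) (T : ℕ) (ω : Ω) : Prop :=
  let Zhat := hatSample Pol ε δ (fun i => x i ω) (fun i => ℓ i ω) (fun i => act i ω)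
    (fun i => pol i ω) T
  let Ztilde := tildeSample Pol ε δ (fun i => x i ω) (fun i => ℓ i ω) (fun i => act i ω)
    (fun i => pol i ω) T
  let Z := fullSample (fun i => x i ω) (fun i => ℓ i ω) T
  let e := errRate Pol.card δ T
  ∀ π ∈ Pol,
    |(empLoss Zhat π - empLoss Zhat πs) - (empLoss Ztilde π - empLoss Ztilde πs)|
        ≤ Real.sqrt (2 * K * rho D π πs * e / ε) + (K / ε + 1) * e ∧
    |(empLoss Z π - empLoss Z πs) - (expLoss D π - expLoss D πs)|
        ≤ Real.sqrt (rho D π πs * e) + 2 * e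

/-- The event that the deviation bounds hold at all times `1 ≤ T ≤ n`. -/
def goodUpTo (D : Measure (X × (Fin K → ℝ))) (Pol : Finset (Policy X K)) (πs : Policy X K)
    (ε δ : ℝ) (x : ℕ → Ω → X) (ℓ : ℕ → Ω → Fin K → ℝ) (act : ℕ → Ω → Fin K)
    (pol : ℕ → Ω → Policy X K) (n : ℕ) : Set Ω :=
  {ω | ∀ T, 1 ≤ T → T ≤ n → DeviationAt D Pol πs ε δ x ℓ act pol T ω}

/-- The event `E` that the deviation bounds hold at all times `T ≥ 1`. -/
def goodEvent (D : Measure (X × (Fin K → ℝ))) (Pol : Finset (Policy X K)) (πs : Policy X K)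
    (ε δ : ℝ) (x : ℕ → Ω → X) (ℓ : ℕ → Ω → Fin K → ℝ) (act : ℕ → Ω → Fin K)
    (pol : ℕ → Ω → Policy X K) : Set Ω :=
  {ω | ∀ T, 1 ≤ T → DeviationAt D Pol πs ε δ x ℓ act pol T ω}

/-- Regret incurred in round `t`: `ℓ_t(a_t) - ℓ_t(π*(x_t))`. -/
def instRegret (πs : Policy X K) (x : ℕ → Ω → X) (ℓ : ℕ → Ω → Fin K → ℝ) (act : ℕ → Ω → Fin K)
    (t : ℕ) (ω : Ω) : ℝ :=
  ℓ t ω (act t ω) - ℓ t ω (πs (x t ω))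

/-- Cumulative regret `R_T`. -/
def regret (πs : Policy X K) (x : ℕ → Ω → X) (ℓ : ℕ → Ω → Fin K → ℝ) (act : ℕ → Ω → Fin K)
    (T : ℕ) (ω : Ω) : ℝ :=
  ∑ t ∈ Finset.Icc 1 T, instRegret πs x ℓ act t ω

end Runs

end ActiveGreedy

/-!
On the good event the bias of the estimated losses is favourable: an unexplored action is charged
the maximal loss `1`, so as long as the action of `πs` is explored, an empirical gap
`L(π, Ẑ) - L(πs, Ẑ)` underestimates `L(π) - L(πs)` by at most `Δ_t`. By induction on the round this
keeps the action of `πs` explored, and it bounds the expected regret of the greedy policy by `Δ_t`;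
exploration adds at most `ε`. Every explored action is that of a policy with
`L(π) - L(πs) ≤ 2 Δ_t`, so once `2 Δ_t < τ` only the action of `πs` can be played.

The event that the deviation bounds hold before round `t` belongs to the past of that round, so the
regret stopped at their first failure inherits the conditional bounds in expectation. It coincides
with the regret on the good event, and only the first `T₀` rounds contribute to it.
-/

namespace ActiveGreedy

section Sums

variable {ι M : Type*} [AddCommMonoid M] [PartialOrder M] [IsOrderedAddMonoid M]

lemma sum_le_sum_of_le_of_nonpos {s u : Finset ι} {c b : ι → M}
    (hle : ∀ i ∈ s, i ∈ u → c i ≤ b i) (hnonpos : ∀ i ∈ s, i ∉ u → c i ≤ 0)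
    (hb : ∀ i ∈ u, 0 ≤ b i) : ∑ i ∈ s, c i ≤ ∑ i ∈ u, b i := by
  classical
  calc ∑ i ∈ s, c i = ∑ i ∈ s ∩ u, c i + ∑ i ∈ s \ u, c i :=
        (Finset.sum_inter_add_sum_sdiff s u c).symm
    _ ≤ ∑ i ∈ s ∩ u, b i + 0 := by
        refine add_le_add (Finset.sum_le_sum fun i hi => ?_) (Finset.sum_nonpos fun i hi => ?_)
        · exact hle i (Finset.mem_inter.1 hi).1 (Finset.mem_inter.1 hi).2
        · exact hnonpos i (Finset.mem_sdiff.1 hi).1 (Finset.mem_sdiff.1 hi).2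
    _ ≤ ∑ i ∈ u, b i := by
        rw [add_zero]
        exact Finset.sum_le_sum_of_subset_of_nonneg Finset.inter_subset_right fun i hi _ => hb i hi

end Sums

section FiniteSelection

variable {Ω ι : Type*} {s : Finset ι} {J : Ω → ι}

lemma sum_indicator_fiber {M : Type*} [AddCommMonoid M] (hJs : ∀ ω, J ω ∈ s) (F : ι → Ω → M) :
    ∑ i ∈ s, {ω | J ω = i}.indicator (F i) = fun ω => F (J ω) ω := by
  classical
  ext ω
  simp [Finset.sum_apply, Set.indicator_apply, hJs ω]

lemma measurable_of_measurable_on_fibers {γ : Type*} [MeasurableSpace Ω] [MeasurableSpace γ]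
    (hJs : ∀ ω, J ω ∈ s) (hJ : ∀ i ∈ s, MeasurableSet {ω | J ω = i}) {F : ι → Ω → γ}
    (hF : ∀ i ∈ s, Measurable (F i)) : Measurable fun ω => F (J ω) ω := by
  intro t ht
  have hpreimage : (fun ω => F (J ω) ω) ⁻¹' t = ⋃ i ∈ s, {ω | J ω = i} ∩ F i ⁻¹' t := by
    ext ω
    simp [hJs ω]
  rw [hpreimage]
  exact Finset.measurableSet_biUnion s fun i hi => (hJ i hi).inter (hF i hi ht)

variable {m mΩ : MeasurableSpace Ω} {μ : Measure Ω}

lemma condExp_apply_of_fibers_measurable (hm : m ≤ mΩ) (hJs : ∀ ω, J ω ∈ s)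
    (hJ : ∀ i ∈ s, MeasurableSet[m] {ω | J ω = i}) {F : ι → Ω → ℝ}
    (hF : ∀ i ∈ s, Integrable (F i) μ) :
    μ[fun ω => F (J ω) ω | m] =ᵐ[μ] fun ω => (μ[F (J ω) | m]) ω := by
  rw [← sum_indicator_fiber hJs F, ← sum_indicator_fiber hJs fun i => μ[F i | m]]
  have hfiber : ∀ᵐ ω ∂μ, ∀ i ∈ s, (μ[{ω | J ω = i}.indicator (F i) | m]) ω
      = {ω | J ω = i}.indicator (μ[F i | m]) ω :=
    (Finset.eventually_all s).2 fun i hi => condExp_indicator (hF i hi) (hJ i hi)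
  filter_upwards [condExp_finsetSum
    (fun i hi => (hF i hi).indicator (hm _ (hJ i hi))) m, hfiber] with ω hsum hω
  rw [hsum, Finset.sum_apply, Finset.sum_apply]
  exact Finset.sum_congr rfl hω

lemma condExp_apply_of_stronglyMeasurable [IsFiniteMeasure μ] (hm : m ≤ mΩ)
    (hJs : ∀ ω, J ω ∈ s) (hJ : ∀ i ∈ s, MeasurableSet {ω | J ω = i}) {F : ι → Ω → ℝ}
    (hF : ∀ i ∈ s, StronglyMeasurable[m] (F i)) {c : ℝ} (hc : ∀ i ∈ s, ∀ᵐ ω ∂μ, ‖F i ω‖ ≤ c) :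
    μ[fun ω => F (J ω) ω | m] =ᵐ[μ]
      fun ω => ∑ i ∈ s, F i ω * (μ[{ω | J ω = i}.indicator (fun _ => (1 : ℝ)) | m]) ω := by
  have hone : ∀ i ∈ s, Integrable ({ω | J ω = i}.indicator fun _ => (1 : ℝ)) μ := fun i hi =>
    (integrable_const 1).indicator (hJ i hi)
  have hmul : ∀ i, {ω | J ω = i}.indicator (F i)
      = F i * {ω | J ω = i}.indicator (fun _ => (1 : ℝ)) := fun i => by
    ext ω
    rw [Pi.mul_apply, ← Set.indicator_mul_right]
    simp only [mul_one]
  have hpull : ∀ᵐ ω ∂μ, ∀ i ∈ s, (μ[{ω | J ω = i}.indicator (F i) | m]) ω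
      = F i ω * (μ[{ω | J ω = i}.indicator (fun _ => (1 : ℝ)) | m]) ω :=
    (Finset.eventually_all s).2 fun i hi => by
      rw [hmul]
      exact condExp_stronglyMeasurable_mul_of_bound hm (hF i hi) (hone i hi) c (hc i hi)
  have hint : ∀ i ∈ s, Integrable ({ω | J ω = i}.indicator (F i)) μ := fun i hi =>
    (Integrable.of_bound ((hF i hi).mono hm).aestronglyMeasurable c (hc i hi)).indicator (hJ i hi)
  rw [← sum_indicator_fiber hJs]
  filter_upwards [condExp_finsetSum hint m, hpull] with ω hsum hω
  rw [hsum, Finset.sum_apply]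
  exact Finset.sum_congr rfl hω

end FiniteSelection

section Conditioning

variable {Ω : Type*} {m mΩ : MeasurableSpace Ω} {μ : Measure Ω} {f : Ω → ℝ}

lemma integral_cond_eq (f : Ω → ℝ) (E : Set Ω) :
    ∫ ω, f ω ∂μ[|E] = (μ.real E)⁻¹ * ∫ ω in E, f ω ∂μ := by
  rw [ProbabilityTheory.cond, integral_smul_measure, ENNReal.toReal_inv, smul_eq_mul]
  rfl

lemma ae_eq_zero_of_condExp_eq_zero [IsFiniteMeasure μ] (hm : m ≤ mΩ) (hf : Integrable f μ)
    (hf0 : 0 ≤ᵐ[μ] f) : ∀ᵐ ω ∂μ, (μ[f | m]) ω = 0 → f ω = 0 := by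
  have hS : MeasurableSet[m] {ω | (μ[f | m]) ω = 0} :=
    stronglyMeasurable_condExp.measurable (measurableSet_singleton 0)
  have hint : ∫ ω in {ω | (μ[f | m]) ω = 0}, f ω ∂μ = 0 := by
    rw [← setIntegral_condExp hm hf hS]
    exact setIntegral_eq_zero_of_forall_eq_zero fun ω hω => hω
  exact (ae_restrict_iff' (hm _ hS)).1
    ((setIntegral_eq_zero_iff_of_nonneg_ae (ae_restrict_of_ae hf0) hf.integrableOn).1 hint)

lemma integral_cond_le [IsFiniteMeasure μ] (hf : Integrable f μ) {c : ℝ} (hc : 0 ≤ c)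
    (hfc : ∀ᵐ ω ∂μ, f ω ≤ c) (E : Set Ω) : ∫ ω, f ω ∂μ[|E] ≤ c := by
  have hle : ∫ ω in E, f ω ∂μ ≤ μ.real E * c := by
    simpa using setIntegral_mono_ae hf.integrableOn (integrable_const c).integrableOn hfc
  calc ∫ ω, f ω ∂μ[|E] = (μ.real E)⁻¹ * ∫ ω in E, f ω ∂μ := integral_cond_eq f E
    _ ≤ (μ.real E)⁻¹ * (μ.real E * c) := by gcongr
    _ ≤ c := by
        rw [← mul_assoc]
        exact mul_le_of_le_one_left hc (inv_mul_le_one)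

variable [IsProbabilityMeasure μ]

lemma integral_indicator_le_of_condExp_le (hm : m ≤ mΩ) (hf : Integrable f μ) {s : Set Ω}
    (hs : MeasurableSet[m] s) {c : ℝ} (hc : 0 ≤ c) (hle : ∀ᵐ ω ∂μ, ω ∈ s → (μ[f | m]) ω ≤ c) :
    ∫ ω, s.indicator f ω ∂μ ≤ c :=
  calc ∫ ω, s.indicator f ω ∂μ = ∫ ω in s, (μ[f | m]) ω ∂μ := by
        rw [integral_indicator (hm _ hs), setIntegral_condExp hm hf hs]
    _ ≤ ∫ _ in s, c ∂μ := setIntegral_mono_on_ae integrable_condExp.integrableOn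
        (integrable_const c).integrableOn (hm _ hs) hle
    _ = μ.real s * c := by simp
    _ ≤ c := mul_le_of_le_one_left hc measureReal_le_one

lemma integral_cond_le_of_neg_le (hf : Integrable f μ) {B c : ℝ} (hB : 0 ≤ B)
    (hfB : ∫ ω, f ω ∂μ ≤ B) (hfc : ∀ᵐ ω ∂μ, -c ≤ f ω) {E : Set Ω} (hE : MeasurableSet E) :
    ∫ ω, f ω ∂μ[|E] ≤ B + (B + c) * (μ.real Eᶜ / μ.real E) := by
  rw [integral_cond_eq]
  rcases eq_or_ne (μ.real E) 0 with h0 | h0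
  · simpa [h0] using hB
  have hpos : 0 < μ.real E := lt_of_le_of_ne measureReal_nonneg h0.symm
  have hcompl : μ.real Eᶜ * -c ≤ ∫ ω in Eᶜ, f ω ∂μ := by
    simpa using setIntegral_mono_ae (integrable_const (-c)).integrableOn hf.integrableOn hfc
  have hone : μ.real E + μ.real Eᶜ = 1 := probReal_add_probReal_compl hE
  rw [inv_mul_le_iff₀ hpos]
  calc ∫ ω in E, f ω ∂μ = ∫ ω, f ω ∂μ - ∫ ω in Eᶜ, f ω ∂μ :=
        eq_sub_of_add_eq (integral_add_compl hE hf)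
    _ ≤ B * (μ.real E + μ.real Eᶜ) + μ.real Eᶜ * c := by rw [hone]; linarith
    _ = μ.real E * (B + (B + c) * (μ.real Eᶜ / μ.real E)) := by field_simp; ring

end Conditioning

section Thresholds

variable {K N : ℕ} {ε δ τ : ℝ}

lemma errRate_nonneg (hδ : 0 < δ) (hδN : δ ≤ N) (T : ℕ) : 0 ≤ errRate N δ T := by
  rcases Nat.eq_zero_or_pos T with rfl | hT
  · simp [errRate]
  · have hT1 : (1 : ℝ) ≤ T := by exact_mod_cast hT
    refine div_nonneg (Real.log_nonneg ?_) (by positivity)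
    rw [le_div_iff₀ (by positivity), one_mul, div_le_iff₀ (by positivity)]
    nlinarith

lemma threshold_nonneg (hε : 0 < ε) (hδ : 0 < δ) (hδN : δ ≤ N) (t : ℕ) :
    0 ≤ threshold K N ε δ t := by
  have := errRate_nonneg hδ hδN (t - 1)
  unfold threshold
  positivity

lemma errRate_eq_add (hN : N ≠ 0) (hδ : δ ≠ 0) {T : ℕ} (hT : T ≠ 0) :
    errRate N δ T
      = Real.log (2 * N / δ) / T + Real.log T / T + Real.log (T + 1) / T := by
  have hT' : (T : ℝ) ≠ 0 := by exact_mod_cast hT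
  have hT1 : (T : ℝ) + 1 ≠ 0 := by positivity
  have hfactor : 2 * N / (δ / ((T : ℝ) ^ 2 + T)) = 2 * N / δ * T * (T + 1) := by
    field_simp
  rw [errRate, hfactor, Real.log_mul (by positivity) hT1, Real.log_mul (by positivity) hT',
    add_div, add_div]

lemma tendsto_errRate (hN : N ≠ 0) (hδ : δ ≠ 0) :
    Filter.Tendsto (errRate N δ) Filter.atTop (nhds 0) := by
  have hlog : Filter.Tendsto (fun T : ℕ => Real.log T / T) Filter.atTop (nhds 0) := by
    simpa [Function.comp_def] using (Real.tendsto_pow_log_div_mul_add_atTop 1 0 1 one_ne_zero).comp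
      (tendsto_natCast_atTop_atTop (R := ℝ))
  have hlog_succ : Filter.Tendsto (fun T : ℕ => Real.log (T + 1) / T) Filter.atTop (nhds 0) := by
    simpa [Function.comp_def] using
      (Real.tendsto_pow_log_div_mul_add_atTop 1 (-1) 1 one_ne_zero).comp
        (Filter.tendsto_atTop_add_const_right _ 1 (tendsto_natCast_atTop_atTop (R := ℝ)))
  have hsum := ((tendsto_const_div_atTop_nhds_zero_nat (Real.log (2 * N / δ))).add hlog).add
    hlog_succ
  rw [add_zero, add_zero] at hsum
  refine hsum.congr' ?_
  filter_upwards [Filter.eventually_ne_atTop 0] with T hT using (errRate_eq_add hN hδ hT).symm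

lemma tendsto_threshold (hN : N ≠ 0) (hδ : δ ≠ 0) :
    Filter.Tendsto (threshold K N ε δ) Filter.atTop (nhds 0) := by
  have herr := (tendsto_errRate hN hδ).comp (Filter.tendsto_sub_atTop_nat 1)
  have hsqrt : Filter.Tendsto (fun T : ℕ => √(errRate N δ (T - 1))) Filter.atTop (nhds 0) := by
    simpa [Function.comp_def] using (Real.continuous_sqrt.tendsto 0).comp herr
  have hsum := (hsqrt.const_mul (√(2 * K / ε) + 1)).add (herr.const_mul (K / ε + 3))
  rwa [mul_zero, mul_zero, add_zero] at hsum

lemma isGreatest_lastRound (hN : N ≠ 0) (hδ : δ ≠ 0) (hτ : 0 < τ) :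
    IsGreatest (unresolvedRounds K N ε δ τ) (lastRound K N ε δ τ) := by
  have hbdd : BddAbove (unresolvedRounds K N ε δ τ) := by
    obtain ⟨M, hM⟩ := Filter.eventually_atTop.1
      ((tendsto_threshold (K := K) (ε := ε) hN hδ).eventually (gt_mem_nhds (half_pos hτ)))
    refine ⟨max M 1, ?_⟩
    rintro t (rfl | ⟨_, ht⟩)
    · exact le_max_right _ _
    · by_contra hlt
      linarith [hM t (by omega)]
  exact ⟨Nat.sSup_mem ⟨1, Or.inl rfl⟩ hbdd, fun t ht => le_csSup hbdd ht⟩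

lemma one_le_lastRound (hN : N ≠ 0) (hδ : δ ≠ 0) (hτ : 0 < τ) : 1 ≤ lastRound K N ε δ τ :=
  (isGreatest_lastRound hN hδ hτ).2 (Or.inl rfl)

lemma two_mul_threshold_lt (hN : N ≠ 0) (hδ : δ ≠ 0) (hτ : 0 < τ) {t : ℕ}
    (ht : lastRound K N ε δ τ < t) : 2 * threshold K N ε δ t < τ := by
  have hone := one_le_lastRound (K := K) (ε := ε) hN hδ hτ
  by_contra! hle
  exact ht.not_ge ((isGreatest_lastRound hN hδ hτ).2 (Or.inr ⟨by omega, hle⟩))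

/-- The bound on the expected regret of round `t`, as long as the deviation bounds hold: the trivial
bound `1` in the first round, where `Δ_1 = ∞`, and `Δ_t + ε` from then on. -/
noncomputable def roundBound (K N : ℕ) (ε δ : ℝ) (t : ℕ) : ℝ :=
  if t = 1 then 1 else threshold K N ε δ t + ε

lemma roundBound_nonneg (hε : 0 < ε) (hδ : 0 < δ) (hδN : δ ≤ N) (t : ℕ) :
    0 ≤ roundBound K N ε δ t := by
  have := threshold_nonneg (K := K) hε hδ hδN t
  unfold roundBound
  positivity

lemma regretBound_eq_sum_roundBound (hN : N ≠ 0) (hδ : δ ≠ 0) (hτ : 0 < τ) :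
    regretBound K N ε δ τ = ∑ t ∈ Finset.Icc 1 (lastRound K N ε δ τ), roundBound K N ε δ t := by
  rw [← Finset.add_sum_Ioc_eq_sum_Icc (one_le_lastRound hN hδ hτ), regretBound]
  refine congrArg₂ (· + ·) (if_pos rfl).symm (Finset.sum_congr rfl fun t ht => ?_)
  exact (if_neg (Finset.mem_Ioc.1 ht).1.ne').symm

lemma regretBound_nonneg (hε : 0 < ε) (hδ : 0 < δ) (hδN : δ ≤ N) :
    0 ≤ regretBound K N ε δ τ :=
  add_nonneg zero_le_one (Finset.sum_nonneg fun t _ =>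
    add_nonneg (threshold_nonneg hε hδ hδN t) hε.le)

lemma sum_le_regretBound (hε : 0 < ε) (hδ : 0 < δ) (hδN : δ ≤ N) (hτ : 0 < τ)
    {c : ℕ → ℝ} (hle : ∀ t, 1 ≤ t → c t ≤ roundBound K N ε δ t)
    (hlate : ∀ t, lastRound K N ε δ τ < t → c t ≤ 0) (T : ℕ) :
    ∑ t ∈ Finset.Icc 1 T, c t ≤ regretBound K N ε δ τ := by
  have hN : N ≠ 0 := by exact_mod_cast (hδ.trans_le hδN).ne'
  rw [regretBound_eq_sum_roundBound hN hδ.ne' hτ]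
  refine sum_le_sum_of_le_of_nonpos (fun t ht _ => hle t (Finset.mem_Icc.1 ht).1)
    (fun t ht hnot => hlate t ?_) fun t _ => roundBound_nonneg hε hδ hδN t
  rw [Finset.mem_Icc] at ht hnot
  omega

end Thresholds

section Oracle

variable {X : Type*} {K : ℕ} {Pol : Finset (Policy X K)} {ε δ : ℝ} {x : ℕ → X}
  {ℓ : ℕ → Fin K → ℝ} {act : ℕ → Fin K} {pol : ℕ → Policy X K} {π πs : Policy X K}

lemma mem_exploreSet_iff {Δ : ℝ} {Z : Sample X K} {πt : Policy X K} {x : X} {a : Fin K} :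
    a ∈ exploreSet Pol Δ Z πt x ↔ ∃ π ∈ Pol, π x = a ∧ empLoss Z π - empLoss Z πt ≤ Δ := by
  classical
  simp only [exploreSet, Finset.mem_filter, Finset.mem_univ, true_and]
  constructor
  · rintro ⟨π, ⟨⟨hπ, hπa⟩, -⟩, hle⟩
    exact ⟨π, hπ, hπa, hle⟩
  · rintro ⟨π, hπ, hπa, hle⟩
    obtain ⟨πa, hmem, hmin⟩ := Finset.exists_min_image (Pol.filter fun π' => π' x = a)
      (empLoss Z) ⟨π, Finset.mem_filter.2 ⟨hπ, hπa⟩⟩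
    simp only [Finset.mem_filter] at hmem hmin
    exact ⟨πa, ⟨hmem, hmin⟩, (sub_le_sub_right (hmin π ⟨hπ, hπa⟩) _).trans hle⟩

lemma greedy_mem_exploredAt (hε : 0 < ε) (hδ : 0 < δ) (hδN : δ ≤ Pol.card) {t : ℕ}
    (hpol : pol t ∈ Pol) : pol t (x t) ∈ exploredAt Pol ε δ x ℓ act pol t :=
  mem_exploreSet_iff.2 ⟨_, hpol, rfl, by
    rw [sub_self]
    exact threshold_nonneg hε hδ hδN t⟩

lemma length_hatSample (T : ℕ) : (hatSample Pol ε δ x ℓ act pol T).length = T := by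
  induction T with
  | zero => rfl
  | succ T ih => rw [hatSample, List.length_cons, ih]

lemma sum_hatSample (π : Policy X K) (T : ℕ) :
    ((hatSample Pol ε δ x ℓ act pol T).map fun z => z.2 (π z.1)).sum
      = ∑ i ∈ Finset.range T, hatLoss (exploredAt Pol ε δ x ℓ act pol (i + 1))
          (probAt Pol ε δ x ℓ act pol (i + 1) (act (i + 1))) (act (i + 1)) (ℓ (i + 1))
          (π (x (i + 1))) := by
  induction T with
  | zero => rfl
  | succ T ih =>
    rw [Finset.sum_range_succ, ← ih]
    exact add_comm _ _

lemma empLoss_hatSample (π : Policy X K) (T : ℕ) :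
    empLoss (hatSample Pol ε δ x ℓ act pol T) π
      = (∑ i ∈ Finset.range T, hatLoss (exploredAt Pol ε δ x ℓ act pol (i + 1))
          (probAt Pol ε δ x ℓ act pol (i + 1) (act (i + 1))) (act (i + 1)) (ℓ (i + 1))
          (π (x (i + 1)))) / T := by
  rw [empLoss, sum_hatSample, length_hatSample]

lemma empLoss_tildeSample (π : Policy X K) (T : ℕ) :
    empLoss (tildeSample Pol ε δ x ℓ act pol T) π
      = (∑ i ∈ Finset.range T, tildeLoss (exploredAt Pol ε δ x ℓ act pol (i + 1)) (ℓ (i + 1))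
          (π (x (i + 1)))) / T := by
  simp only [empLoss, tildeSample, List.map_map, List.length_map, List.length_range]
  rfl

lemma empLoss_fullSample (π : Policy X K) (T : ℕ) :
    empLoss (fullSample x ℓ T) π = (∑ i ∈ Finset.range T, ℓ (i + 1) (π (x (i + 1)))) / T := by
  simp only [empLoss, fullSample, List.map_map, List.length_map, List.length_range]
  rfl

lemma le_tildeLoss {A : Finset (Fin K)} {c : Fin K → ℝ} {a : Fin K} (hc : c a ≤ 1) :
    c a ≤ tildeLoss A c a := by
  unfold tildeLoss
  split_ifs
  exacts [le_rfl, hc]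

lemma empLoss_fullSample_sub_le (hℓ : ∀ t a, ℓ (t + 1) a ≤ 1) {T : ℕ}
    (hexplored : ∀ i < T, πs (x (i + 1)) ∈ exploredAt Pol ε δ x ℓ act pol (i + 1)) :
    empLoss (fullSample x ℓ T) π - empLoss (fullSample x ℓ T) πs
      ≤ empLoss (tildeSample Pol ε δ x ℓ act pol T) π
        - empLoss (tildeSample Pol ε δ x ℓ act pol T) πs := by
  have hπs : empLoss (tildeSample Pol ε δ x ℓ act pol T) πs = empLoss (fullSample x ℓ T) πs := by
    rw [empLoss_tildeSample, empLoss_fullSample]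
    exact congrArg (· / (T : ℝ)) <| Finset.sum_congr rfl fun i hi =>
      if_pos (hexplored i (Finset.mem_range.1 hi))
  rw [hπs, empLoss_fullSample, empLoss_tildeSample]
  gcongr
  exact le_tildeLoss (hℓ _ _)

variable {A : Finset (Fin K)} {g : Fin K}

lemma actionProb_eq_zero {a : Fin K} (hg : g ∈ A) (ha : a ∉ A) : actionProb ε A g a = 0 := by
  rw [actionProb, if_neg (ne_of_mem_of_not_mem hg ha).symm, if_neg ha]

lemma actionProb_eq_add (hg : g ∈ A) (a : Fin K) :
    actionProb ε A g a
      = (if a = g then 1 - A.card * (ε / K) else 0) + if a ∈ A then ε / K else 0 := by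
  rcases eq_or_ne a g with rfl | hne
  · rw [actionProb, if_pos rfl, if_pos rfl, if_pos hg]
    ring
  · rw [actionProb, if_neg hne, if_neg hne, zero_add]

lemma sum_actionProb_mul (hg : g ∈ A) (c : Fin K → ℝ) :
    ∑ a, actionProb ε A g a * c a = c g + ε / K * ∑ a ∈ A, (c a - c g) := by
  simp only [actionProb_eq_add hg, add_mul, ite_mul, zero_mul, Finset.sum_add_distrib,
    Finset.sum_ite_eq', Finset.mem_univ, if_true, Finset.sum_ite_mem, Finset.univ_inter,
    Finset.sum_sub_distrib, Finset.sum_const, nsmul_eq_mul, ← Finset.mul_sum]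
  ring

lemma sum_actionProb_mul_le (hε : 0 ≤ ε) (hg : g ∈ A) {c : Fin K → ℝ}
    (hc : ∀ a, c a ≤ c g + 1) : ∑ a, actionProb ε A g a * c a ≤ c g + ε := by
  have hK : (K : ℝ) ≠ 0 := by exact_mod_cast g.pos.ne'
  have hsum : ∑ a ∈ A, (c a - c g) ≤ K :=
    calc ∑ a ∈ A, (c a - c g) ≤ A.card • (1 : ℝ) :=
          Finset.sum_le_card_nsmul _ _ _ fun a _ => by linarith [hc a]
      _ ≤ K := by
          rw [nsmul_one]
          exact_mod_cast (Finset.card_le_univ A).trans_eq (Fintype.card_fin K)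
  calc ∑ a, actionProb ε A g a * c a = c g + ε / K * ∑ a ∈ A, (c a - c g) :=
        sum_actionProb_mul hg c
    _ ≤ c g + ε / K * K := by gcongr
    _ = c g + ε := by rw [div_mul_cancel₀ _ hK]

end Oracle

section Trajectory

variable {X : Type*} [MeasurableSpace X] {K : ℕ} {Ω : Type*}
  {D : Measure (X × (Fin K → ℝ))} [IsProbabilityMeasure D] {Pol : Finset (Policy X K)}
  {π πs : Policy X K} {ε δ : ℝ} {x : ℕ → Ω → X} {ℓ : ℕ → Ω → Fin K → ℝ} {act : ℕ → Ω → Fin K}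
  {pol : ℕ → Ω → Policy X K} {ω : Ω} {n : ℕ}

lemma deviation_add_le_threshold (hε : 0 < ε) (hδ : 0 < δ) {N : ℕ} (hδN : δ ≤ N) (T : ℕ) :
    (√(2 * K * rho D π πs * errRate N δ T / ε) + (K / ε + 1) * errRate N δ T)
        + (√(rho D π πs * errRate N δ T) + 2 * errRate N δ T)
      ≤ threshold K N ε δ (T + 1) := by
  have herr := errRate_nonneg hδ hδN T
  have hρ : rho D π πs ≤ 1 := measureReal_le_one
  have hhat : √(2 * K * rho D π πs * errRate N δ T / ε) ≤ √(2 * K / ε) * √(errRate N δ T) := by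
    rw [← Real.sqrt_mul (by positivity)]
    refine Real.sqrt_le_sqrt ?_
    calc 2 * K * rho D π πs * errRate N δ T / ε
        = 2 * K / ε * errRate N δ T * rho D π πs := by ring
      _ ≤ 2 * K / ε * errRate N δ T := mul_le_of_le_one_right (by positivity) hρ
  have hfull : √(rho D π πs * errRate N δ T) ≤ √(errRate N δ T) :=
    Real.sqrt_le_sqrt (mul_le_of_le_one_left herr hρ)
  rw [threshold, Nat.add_sub_cancel]
  linarith

lemma expLoss_sub_le_of_deviationAt (hε : 0 < ε) (hδ : 0 < δ) (hδN : δ ≤ Pol.card)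
    (hℓ : ∀ t a, ℓ (t + 1) ω a ≤ 1) (hdev : DeviationAt D Pol πs ε δ x ℓ act pol n ω)
    (hexplored : ∀ i < n, πs (x (i + 1) ω)
      ∈ exploredAt Pol ε δ (x · ω) (ℓ · ω) (act · ω) (pol · ω) (i + 1)) (hπ : π ∈ Pol) :
    expLoss D π - expLoss D πs
      ≤ empLoss (hatSample Pol ε δ (x · ω) (ℓ · ω) (act · ω) (pol · ω) n) π
        - empLoss (hatSample Pol ε δ (x · ω) (ℓ · ω) (act · ω) (pol · ω) n) πs
        + threshold K Pol.card ε δ (n + 1) := by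
  obtain ⟨hhat, hfull⟩ := hdev π hπ
  have hbias := empLoss_fullSample_sub_le (π := π) hℓ hexplored
  have hthreshold := deviation_add_le_threshold (D := D) (K := K) (π := π) (πs := πs) hε hδ hδN n
  linarith [(abs_le.1 hhat).1, (abs_le.1 hfull).1]

lemma optimal_mem_exploredAt (hπs : IsOptimal D Pol πs) (hε : 0 < ε) (hδ : 0 < δ)
    (hδN : δ ≤ Pol.card) (hℓ : ∀ t a, ℓ (t + 1) ω a ≤ 1)
    (hpol : ∀ t, pol (t + 1) ω ∈ Pol) (hgood : ω ∈ goodUpTo D Pol πs ε δ x ℓ act pol n) :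
    ∀ i ≤ n, πs (x (i + 1) ω)
      ∈ exploredAt Pol ε δ (x · ω) (ℓ · ω) (act · ω) (pol · ω) (i + 1) := by
  intro i
  induction i using Nat.strong_induction_on with
  | _ i ih =>
    intro hi
    refine mem_exploreSet_iff.2 ⟨πs, hπs.1, rfl, ?_⟩
    rw [Nat.add_sub_cancel]
    rcases Nat.eq_zero_or_pos i with rfl | hpos
    · simpa [hatSample, empLoss] using threshold_nonneg hε hδ hδN 1
    · have hgap := expLoss_sub_le_of_deviationAt hε hδ hδN hℓ (hgood i hpos hi)
        (fun j hj => ih j hj (hj.le.trans hi)) (hpol i)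
      linarith [hπs.2 _ (hpol i)]

lemma expLoss_sub_le_of_mem_goodUpTo (hπs : IsOptimal D Pol πs) (hε : 0 < ε) (hδ : 0 < δ)
    (hδN : δ ≤ Pol.card) (hℓ : ∀ t a, ℓ (t + 1) ω a ≤ 1) (hpol : ∀ t, pol (t + 1) ω ∈ Pol)
    (hn : 1 ≤ n) (hgood : ω ∈ goodUpTo D Pol πs ε δ x ℓ act pol n) (hπ : π ∈ Pol) :
    expLoss D π - expLoss D πs
      ≤ empLoss (hatSample Pol ε δ (x · ω) (ℓ · ω) (act · ω) (pol · ω) n) π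
        - empLoss (hatSample Pol ε δ (x · ω) (ℓ · ω) (act · ω) (pol · ω) n) πs
        + threshold K Pol.card ε δ (n + 1) :=
  expLoss_sub_le_of_deviationAt hε hδ hδN hℓ (hgood n hn le_rfl)
    (fun i hi => optimal_mem_exploredAt hπs hε hδ hδN hℓ hpol hgood i hi.le) hπ

lemma expLoss_greedy_sub_le (hπs : IsOptimal D Pol πs) (hε : 0 < ε) (hδ : 0 < δ)
    (hδN : δ ≤ Pol.card) (hℓ : ∀ t a, ℓ (t + 1) ω a ≤ 1)
    (harg : ∀ t, IsArgmin (Pol : Set (Policy X K))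
      (hatSample Pol ε δ (x · ω) (ℓ · ω) (act · ω) (pol · ω) t) (pol (t + 1) ω))
    (hn : 1 ≤ n) (hgood : ω ∈ goodUpTo D Pol πs ε δ x ℓ act pol n) :
    expLoss D (pol (n + 1) ω) - expLoss D πs ≤ threshold K Pol.card ε δ (n + 1) := by
  have hgap := expLoss_sub_le_of_mem_goodUpTo hπs hε hδ hδN hℓ (fun t => (harg t).1) hn hgood
    (harg n).1
  linarith [(harg n).2 πs hπs.1]

lemma exists_policy_of_mem_exploredAt (hπs : IsOptimal D Pol πs) (hε : 0 < ε) (hδ : 0 < δ)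
    (hδN : δ ≤ Pol.card) (hℓ : ∀ t a, ℓ (t + 1) ω a ≤ 1)
    (harg : ∀ t, IsArgmin (Pol : Set (Policy X K))
      (hatSample Pol ε δ (x · ω) (ℓ · ω) (act · ω) (pol · ω) t) (pol (t + 1) ω))
    (hn : 1 ≤ n) (hgood : ω ∈ goodUpTo D Pol πs ε δ x ℓ act pol n) {a : Fin K}
    (ha : a ∈ exploredAt Pol ε δ (x · ω) (ℓ · ω) (act · ω) (pol · ω) (n + 1)) :
    ∃ π ∈ Pol, π (x (n + 1) ω) = a ∧
      expLoss D π - expLoss D πs ≤ 2 * threshold K Pol.card ε δ (n + 1) := by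
  obtain ⟨π, hπ, hπa, hle⟩ := mem_exploreSet_iff.1 ha
  rw [Nat.add_sub_cancel] at hle
  have hgap := expLoss_sub_le_of_mem_goodUpTo hπs hε hδ hδN hℓ (fun t => (harg t).1) hn hgood hπ
  exact ⟨π, hπ, hπa, by linarith [(harg n).2 πs hπs.1]⟩

end Trajectory

section Measurability

variable {X Ω : Type*} [MeasurableSpace X] {m : MeasurableSpace Ω} {K : ℕ}
  {D : Measure (X × (Fin K → ℝ))} {Pol : Finset (Policy X K)} {π πs : Policy X K} {ε δ : ℝ}

section RandomActions

variable {A : Ω → Finset (Fin K)} {a g act : Ω → Fin K} {c : Ω → Fin K → ℝ} {p : Ω → ℝ}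

lemma measurable_loss_apply (hc : Measurable c) (ha : Measurable a) :
    Measurable fun ω => c ω (a ω) :=
  measurable_of_measurable_on_fibers (s := Finset.univ) (F := fun b ω => c ω b)
    (fun _ => Finset.mem_univ _) (fun b _ => ha (measurableSet_singleton b))
    fun b _ => (measurable_pi_apply b).comp hc

lemma measurableSet_mem (hA : Measurable A) (ha : Measurable a) :
    MeasurableSet {ω | a ω ∈ A ω} :=
  (hA.prodMk ha) (MeasurableSet.of_discrete (s := {q : Finset (Fin K) × Fin K | q.2 ∈ q.1}))

lemma measurable_actionProb (hA : Measurable A) (hg : Measurable g) (ha : Measurable a) :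
    Measurable fun ω => actionProb ε (A ω) (g ω) (a ω) :=
  (Measurable.of_discrete (f := fun q : Finset (Fin K) × Fin K × Fin K =>
    actionProb ε q.1 q.2.1 q.2.2)).comp (hA.prodMk (hg.prodMk ha))

lemma measurable_tildeLoss (hA : Measurable A) (hc : Measurable c) (ha : Measurable a) :
    Measurable fun ω => tildeLoss (A ω) (c ω) (a ω) :=
  Measurable.ite (measurableSet_mem hA ha) (measurable_loss_apply hc ha) measurable_const

lemma measurable_hatLoss (hA : Measurable A) (hp : Measurable p) (hact : Measurable act)
    (hc : Measurable c) (ha : Measurable a) :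
    Measurable fun ω => hatLoss (A ω) (p ω) (act ω) (c ω) (a ω) :=
  have hplayed : Measurable fun ω => if a ω = act ω then (1 : ℝ) else 0 :=
    Measurable.ite (measurableSet_eq_fun ha hact) measurable_const measurable_const
  Measurable.ite (measurableSet_mem hA ha) ((hplayed.div hp).mul (measurable_loss_apply hc hact))
    measurable_const

end RandomActions

variable {x : ℕ → Ω → X} {ℓ : ℕ → Ω → Fin K → ℝ} {act : ℕ → Ω → Fin K}
  {pol : ℕ → Ω → Policy X K} {n : ℕ}

/-- The first `n` rounds are known given the σ-algebra `m`. Policies carry no σ-algebra, so the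
choice of the oracle is required to be determined by `m` through its fibres. -/
structure KnownUpTo (m : MeasurableSpace Ω) (Pol : Finset (Policy X K)) (x : ℕ → Ω → X)
    (ℓ : ℕ → Ω → Fin K → ℝ) (act : ℕ → Ω → Fin K) (pol : ℕ → Ω → Policy X K) (n : ℕ) : Prop where
  measurable_x : ∀ i < n, Measurable (x (i + 1))
  measurable_loss : ∀ i < n, Measurable (ℓ (i + 1))
  measurable_act : ∀ i < n, Measurable (act (i + 1))
  pol_mem : ∀ i < n, ∀ ω, pol (i + 1) ω ∈ Pol
  measurableSet_pol_eq : ∀ i < n, ∀ π ∈ Pol, MeasurableSet {ω | pol (i + 1) ω = π}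

namespace KnownUpTo

lemma mono (h : KnownUpTo m Pol x ℓ act pol n) {k : ℕ} (hk : k ≤ n) :
    KnownUpTo m Pol x ℓ act pol k where
  measurable_x i hi := h.measurable_x i (hi.trans_le hk)
  measurable_loss i hi := h.measurable_loss i (hi.trans_le hk)
  measurable_act i hi := h.measurable_act i (hi.trans_le hk)
  pol_mem i hi := h.pol_mem i (hi.trans_le hk)
  measurableSet_pol_eq i hi := h.measurableSet_pol_eq i (hi.trans_le hk)

lemma measurable_greedy (h : KnownUpTo m Pol x ℓ act pol n) (hPol : ∀ π ∈ Pol, Measurable π)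
    {i : ℕ} (hi : i < n) : Measurable fun ω => pol (i + 1) ω (x (i + 1) ω) :=
  measurable_of_measurable_on_fibers (F := fun π ω => π (x (i + 1) ω)) (h.pol_mem i hi)
    (h.measurableSet_pol_eq i hi) fun π hπ => (hPol π hπ).comp (h.measurable_x i hi)

lemma measurable_empLoss_hatSample_of_exploredAt (h : KnownUpTo m Pol x ℓ act pol n)
    (hPol : ∀ π ∈ Pol, Measurable π)
    (hexplored : ∀ i < n,
      Measurable fun ω => exploredAt Pol ε δ (x · ω) (ℓ · ω) (act · ω) (pol · ω) (i + 1))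
    (hπ : Measurable π) :
    Measurable fun ω =>
      empLoss (hatSample Pol ε δ (x · ω) (ℓ · ω) (act · ω) (pol · ω) n) π := by
  simp only [empLoss_hatSample]
  refine Measurable.div_const (Finset.measurable_sum _ fun i hi => ?_) _
  replace hi := Finset.mem_range.1 hi
  exact measurable_hatLoss (hexplored i hi)
    (measurable_actionProb (hexplored i hi) (h.measurable_greedy hPol hi) (h.measurable_act i hi))
    (h.measurable_act i hi) (h.measurable_loss i hi) (hπ.comp (h.measurable_x i hi))

lemma measurable_exploredAt (h : KnownUpTo m Pol x ℓ act pol n) (hPol : ∀ π ∈ Pol, Measurable π) :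
    ∀ i < n, Measurable fun ω =>
      exploredAt Pol ε δ (x · ω) (ℓ · ω) (act · ω) (pol · ω) (i + 1) := by
  intro i
  induction i using Nat.strong_induction_on with
  | _ i ih =>
    intro hi
    have hloss : ∀ π ∈ Pol, Measurable fun ω =>
        empLoss (hatSample Pol ε δ (x · ω) (ℓ · ω) (act · ω) (pol · ω) i) π := fun π hπ =>
      (h.mono hi.le).measurable_empLoss_hatSample_of_exploredAt hPol
        (fun j hj => ih j hj (hj.trans hi)) (hPol π hπ)
    have hgreedy : Measurable fun ω =>
        empLoss (hatSample Pol ε δ (x · ω) (ℓ · ω) (act · ω) (pol · ω) i) (pol (i + 1) ω) :=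
      measurable_of_measurable_on_fibers (F := fun π ω =>
        empLoss (hatSample Pol ε δ (x · ω) (ℓ · ω) (act · ω) (pol · ω) i) π)
        (h.pol_mem i hi) (h.measurableSet_pol_eq i hi) hloss
    refine measurable_finset_iff.2 fun a => measurableSet_setOfPred.1 ?_
    have hunion : {ω | a ∈ exploredAt Pol ε δ (x · ω) (ℓ · ω) (act · ω) (pol · ω) (i + 1)}
        = ⋃ π ∈ Pol, {ω | π (x (i + 1) ω) = a} ∩
          {ω | empLoss (hatSample Pol ε δ (x · ω) (ℓ · ω) (act · ω) (pol · ω) i) π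
            - empLoss (hatSample Pol ε δ (x · ω) (ℓ · ω) (act · ω) (pol · ω) i) (pol (i + 1) ω)
              ≤ threshold K Pol.card ε δ (i + 1)} := by
      ext ω
      simp only [exploredAt, mem_exploreSet_iff, Set.mem_ofPred_eq, Set.mem_iUnion,
        Set.mem_inter_iff, exists_prop, Nat.add_sub_cancel]
    rw [hunion]
    exact Finset.measurableSet_biUnion Pol fun π hπ =>
      (((hPol π hπ).comp (h.measurable_x i hi)) (measurableSet_singleton a)).inter
        (measurableSet_le ((hloss π hπ).sub hgreedy) measurable_const)

lemma measurable_empLoss_hatSample (h : KnownUpTo m Pol x ℓ act pol n)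
    (hPol : ∀ π ∈ Pol, Measurable π) (hπ : Measurable π) :
    Measurable fun ω =>
      empLoss (hatSample Pol ε δ (x · ω) (ℓ · ω) (act · ω) (pol · ω) n) π :=
  h.measurable_empLoss_hatSample_of_exploredAt hPol (h.measurable_exploredAt hPol) hπ

lemma measurable_empLoss_tildeSample (h : KnownUpTo m Pol x ℓ act pol n)
    (hPol : ∀ π ∈ Pol, Measurable π) (hπ : Measurable π) :
    Measurable fun ω =>
      empLoss (tildeSample Pol ε δ (x · ω) (ℓ · ω) (act · ω) (pol · ω) n) π := by
  simp only [empLoss_tildeSample]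
  refine Measurable.div_const (Finset.measurable_sum _ fun i hi => ?_) _
  replace hi := Finset.mem_range.1 hi
  exact measurable_tildeLoss (h.measurable_exploredAt hPol i hi) (h.measurable_loss i hi)
    (hπ.comp (h.measurable_x i hi))

lemma measurable_empLoss_fullSample (h : KnownUpTo m Pol x ℓ act pol n) (hπ : Measurable π) :
    Measurable fun ω => empLoss (fullSample (x · ω) (ℓ · ω) n) π := by
  simp only [empLoss_fullSample]
  refine Measurable.div_const (Finset.measurable_sum _ fun i hi => ?_) _
  replace hi := Finset.mem_range.1 hi
  exact measurable_loss_apply (h.measurable_loss i hi) (hπ.comp (h.measurable_x i hi))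

lemma measurableSet_deviationAt (h : KnownUpTo m Pol x ℓ act pol n)
    (hPol : ∀ π ∈ Pol, Measurable π) (hπs : πs ∈ Pol) :
    MeasurableSet {ω | DeviationAt D Pol πs ε δ x ℓ act pol n ω} := by
  have hhat : ∀ π ∈ Pol, Measurable _ := fun π hπ =>
    h.measurable_empLoss_hatSample (ε := ε) (δ := δ) hPol (hPol π hπ)
  have htilde : ∀ π ∈ Pol, Measurable _ := fun π hπ =>
    h.measurable_empLoss_tildeSample (ε := ε) (δ := δ) hPol (hPol π hπ)
  have hfull : ∀ π ∈ Pol, Measurable _ := fun π hπ => h.measurable_empLoss_fullSample (hPol π hπ)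
  simp only [DeviationAt, Set.ofPred_forall]
  exact Finset.measurableSet_biInter Pol fun π hπ =>
    (measurableSet_le (((hhat π hπ).sub (hhat πs hπs)).sub
      ((htilde π hπ).sub (htilde πs hπs))).abs measurable_const).inter
    (measurableSet_le (((hfull π hπ).sub (hfull πs hπs)).sub measurable_const).abs
      measurable_const)

lemma measurableSet_goodUpTo (h : KnownUpTo m Pol x ℓ act pol n)
    (hPol : ∀ π ∈ Pol, Measurable π) (hπs : πs ∈ Pol) :
    MeasurableSet (goodUpTo D Pol πs ε δ x ℓ act pol n) := by
  simp only [goodUpTo, Set.ofPred_forall]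
  exact MeasurableSet.iInter fun T => MeasurableSet.iInter fun _ => MeasurableSet.iInter fun hT =>
    (h.mono hT).measurableSet_deviationAt hPol hπs

end KnownUpTo

end Measurability

section StoppedRegret

variable {X Ω : Type*} [MeasurableSpace X] {K : ℕ} {D : Measure (X × (Fin K → ℝ))}
  {Pol : Finset (Policy X K)} {πs : Policy X K} {ε δ : ℝ} {x : ℕ → Ω → X}
  {ℓ : ℕ → Ω → Fin K → ℝ} {act : ℕ → Ω → Fin K} {pol : ℕ → Ω → Policy X K}

/-- The regret accumulated until the deviation bounds fail for the first time: round `t` counts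
if they hold at all times `T < t`. -/
noncomputable def stoppedRegret (D : Measure (X × (Fin K → ℝ))) (Pol : Finset (Policy X K))
    (πs : Policy X K) (ε δ : ℝ) (x : ℕ → Ω → X) (ℓ : ℕ → Ω → Fin K → ℝ) (act : ℕ → Ω → Fin K)
    (pol : ℕ → Ω → Policy X K) (T : ℕ) (ω : Ω) : ℝ :=
  ∑ t ∈ Finset.Icc 1 T,
    (goodUpTo D Pol πs ε δ x ℓ act pol (t - 1)).indicator (instRegret πs x ℓ act t) ω

lemma goodEvent_subset_goodUpTo (n : ℕ) :
    goodEvent D Pol πs ε δ x ℓ act pol ⊆ goodUpTo D Pol πs ε δ x ℓ act pol n :=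
  fun _ hω T hT _ => hω T hT

lemma stoppedRegret_eq_regret {ω : Ω} (hω : ω ∈ goodEvent D Pol πs ε δ x ℓ act pol) (T : ℕ) :
    stoppedRegret D Pol πs ε δ x ℓ act pol T ω = regret πs x ℓ act T ω :=
  Finset.sum_congr rfl fun _ _ => Set.indicator_of_mem (goodEvent_subset_goodUpTo _ hω) _

end StoppedRegret

section History

variable {X Ω : Type*} [MeasurableSpace X] {K : ℕ} {x : ℕ → Ω → X} {ℓ : ℕ → Ω → Fin K → ℝ}
  {act : ℕ → Ω → Fin K}

/-- The information the action of round `n + 1` is drawn from: the past and the example of that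
round. -/
abbrev historyWithExample (x : ℕ → Ω → X) (ℓ : ℕ → Ω → Fin K → ℝ) (act : ℕ → Ω → Fin K) (n : ℕ) :
    MeasurableSpace Ω :=
  history x ℓ act n ⊔ MeasurableSpace.comap (fun ω => (x (n + 1) ω, ℓ (n + 1) ω)) inferInstance

lemma measurable_history {n i : ℕ} (hi : i < n) :
    Measurable[history x ℓ act n] fun ω => (x (i + 1) ω, ℓ (i + 1) ω, act (i + 1) ω) :=
  measurable_iff_comap_le.2 <|
    le_iSup₂_of_le (i + 1) (Finset.mem_Icc.2 ⟨Nat.le_add_left 1 i, hi⟩) le_rfl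

lemma history_mono : Monotone (history x ℓ act) := fun _ _ hmn =>
  biSup_mono fun _ hi => Finset.Icc_subset_Icc_right hmn hi

/-- The loss of action `a` in round `t`, in excess of that of the action of `πs`. -/
def excessLoss (πs : Policy X K) (x : ℕ → Ω → X) (ℓ : ℕ → Ω → Fin K → ℝ) (t : ℕ) (a : Fin K)
    (ω : Ω) : ℝ :=
  ℓ t ω a - ℓ t ω (πs (x t ω))

lemma measurable_excessLoss {_ : MeasurableSpace Ω} {πs : Policy X K} {t : ℕ}
    (hx : Measurable (x t)) (hℓ : Measurable (ℓ t)) (hπs : Measurable πs) {a : Ω → Fin K}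
    (ha : Measurable a) : Measurable fun ω => excessLoss πs x ℓ t (a ω) ω :=
  (measurable_loss_apply hℓ ha).sub (measurable_loss_apply hℓ (hπs.comp hx))

end History

namespace IsRun

variable {X Ω : Type*} [MeasurableSpace X] [mΩ : MeasurableSpace Ω] {K : ℕ}
  {μ : Measure Ω} {D : Measure (X × (Fin K → ℝ))} {Pol : Finset (Policy X K)}
  {π πs : Policy X K} {ε δ τ : ℝ} {x : ℕ → Ω → X} {ℓ : ℕ → Ω → Fin K → ℝ} {act : ℕ → Ω → Fin K}
  {pol : ℕ → Ω → Policy X K}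

lemma measurable_example (h : IsRun μ D Pol ε δ x ℓ act pol) (t : ℕ) :
    Measurable fun ω => (x t ω, ℓ t ω) :=
  (h.measurable_x t).prodMk (h.measurable_loss t)

lemma history_le (h : IsRun μ D Pol ε δ x ℓ act pol) (n : ℕ) : history x ℓ act n ≤ mΩ :=
  iSup₂_le fun i _ => measurable_iff_comap_le.1
    ((h.measurable_x i).prodMk ((h.measurable_loss i).prodMk (h.measurable_act i)))

lemma historyWithExample_le (h : IsRun μ D Pol ε δ x ℓ act pol) (n : ℕ) :
    historyWithExample x ℓ act n ≤ mΩ :=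
  sup_le (h.history_le n) (h.measurable_example (n + 1)).comap_le

lemma pol_mem (h : IsRun μ D Pol ε δ x ℓ act pol) (n : ℕ) (ω : Ω) : pol (n + 1) ω ∈ Pol :=
  (h.pol_argmin n ω).1

lemma knownUpTo (h : IsRun μ D Pol ε δ x ℓ act pol) (n : ℕ) :
    KnownUpTo (history x ℓ act n) Pol x ℓ act pol n where
  measurable_x _ hi := measurable_fst.comp (measurable_history hi)
  measurable_loss _ hi := (measurable_fst.comp measurable_snd).comp (measurable_history hi)
  measurable_act _ hi := (measurable_snd.comp measurable_snd).comp (measurable_history hi)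
  pol_mem i _ := h.pol_mem i
  measurableSet_pol_eq i hi π hπ := history_mono hi.le _ (h.pol_past i π hπ)

lemma measurable_greedy (h : IsRun μ D Pol ε δ x ℓ act pol) (hPol : ∀ π ∈ Pol, Measurable π)
    (n : ℕ) : Measurable fun ω => pol (n + 1) ω (x (n + 1) ω) :=
  ((h.knownUpTo (n + 1)).measurable_greedy hPol n.lt_succ_self).mono (h.history_le _) le_rfl

lemma measurableSet_goodUpTo (h : IsRun μ D Pol ε δ x ℓ act pol)
    (hPol : ∀ π ∈ Pol, Measurable π) (hπs : πs ∈ Pol) (n : ℕ) :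
    MeasurableSet[history x ℓ act n] (goodUpTo D Pol πs ε δ x ℓ act pol n) :=
  (h.knownUpTo n).measurableSet_goodUpTo hPol hπs

lemma measurableSet_goodEvent (h : IsRun μ D Pol ε δ x ℓ act pol)
    (hPol : ∀ π ∈ Pol, Measurable π) (hπs : πs ∈ Pol) :
    MeasurableSet (goodEvent D Pol πs ε δ x ℓ act pol) := by
  simp only [goodEvent, Set.ofPred_forall]
  exact MeasurableSet.iInter fun T => MeasurableSet.iInter fun _ =>
    h.history_le T _ ((h.knownUpTo T).measurableSet_deviationAt hPol hπs)

lemma ae_loss_mem_Icc (h : IsRun μ D Pol ε δ x ℓ act pol)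
    (hD : ∀ᵐ z ∂D, ∀ a, z.2 a ∈ Set.Icc (0 : ℝ) 1) :
    ∀ᵐ ω ∂μ, ∀ t a, ℓ (t + 1) ω a ∈ Set.Icc (0 : ℝ) 1 := by
  refine ae_all_iff.2 fun t => ?_
  rw [← h.law t] at hD
  exact ae_of_ae_map (h.measurable_example (t + 1)).aemeasurable hD

lemma ae_abs_excessLoss_le_one (h : IsRun μ D Pol ε δ x ℓ act pol)
    (hD : ∀ᵐ z ∂D, ∀ a, z.2 a ∈ Set.Icc (0 : ℝ) 1) (πs : Policy X K) :
    ∀ᵐ ω ∂μ, ∀ n a, |excessLoss πs x ℓ (n + 1) a ω| ≤ 1 := by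
  filter_upwards [h.ae_loss_mem_Icc hD] with ω hℓ n a
  exact abs_sub_le_of_nonneg_of_le (hℓ n _).1 (hℓ n _).2 (hℓ n _).1 (hℓ n _).2

lemma integral_loss_policy (h : IsRun μ D Pol ε δ x ℓ act pol) (hπ : Measurable π) (n : ℕ) :
    ∫ ω, ℓ (n + 1) ω (π (x (n + 1) ω)) ∂μ = expLoss D π := by
  rw [expLoss, ← h.law n, integral_map (h.measurable_example (n + 1)).aemeasurable]
  exact (measurable_loss_apply measurable_snd (hπ.comp measurable_fst)).aestronglyMeasurable

lemma ae_eq_optimal_of_rho_eq_zero [IsFiniteMeasure D] (h : IsRun μ D Pol ε δ x ℓ act pol)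
    (πs : Policy X K) :
    ∀ᵐ ω ∂μ, ∀ n, ∀ π ∈ Pol, rho D π πs = 0 → π (x (n + 1) ω) = πs (x (n + 1) ω) := by
  refine ae_all_iff.2 fun n => (Finset.eventually_all Pol).2 fun π _ => ?_
  by_cases hρ : rho D π πs = 0
  · have hmap : μ.map (x (n + 1)) = D.fst := by
      rw [← h.law n, Measure.fst_map_prodMk (h.measurable_loss (n + 1))]
    have hagree : ∀ᵐ y ∂D.fst, π y = πs y := (measureReal_eq_zero_iff (by finiteness)).1 hρ
    rw [← hmap] at hagree
    filter_upwards [ae_of_ae_map (h.measurable_x (n + 1)).aemeasurable hagree] with ω hω _ using hω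
  · exact Filter.Eventually.of_forall fun ω hρ' => absurd hρ' hρ

lemma integral_regret_cond_eq (h : IsRun μ D Pol ε δ x ℓ act pol)
    (hPol : ∀ π ∈ Pol, Measurable π) (hπs : πs ∈ Pol) (T : ℕ) :
    ∫ ω, regret πs x ℓ act T ω ∂μ[|goodEvent D Pol πs ε δ x ℓ act pol]
      = ∫ ω, stoppedRegret D Pol πs ε δ x ℓ act pol T ω
          ∂μ[|goodEvent D Pol πs ε δ x ℓ act pol] :=
  integral_congr_ae <| ae_cond_of_forall_mem (h.measurableSet_goodEvent hPol hπs) fun _ hω =>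
    (stoppedRegret_eq_regret hω T).symm

section FiniteMeasure

variable [IsFiniteMeasure μ]

lemma integrable_loss_apply (h : IsRun μ D Pol ε δ x ℓ act pol)
    (hD : ∀ᵐ z ∂D, ∀ a, z.2 a ∈ Set.Icc (0 : ℝ) 1) (n : ℕ) {a : Ω → Fin K} (ha : Measurable a) :
    Integrable (fun ω => ℓ (n + 1) ω (a ω)) μ := by
  refine Integrable.of_bound
    (measurable_loss_apply (h.measurable_loss _) ha).aestronglyMeasurable 1 ?_
  filter_upwards [h.ae_loss_mem_Icc hD] with ω hℓ
  rw [Real.norm_eq_abs, abs_of_nonneg (hℓ n _).1]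
  exact (hℓ n _).2

lemma integrable_excessLoss (h : IsRun μ D Pol ε δ x ℓ act pol)
    (hD : ∀ᵐ z ∂D, ∀ a, z.2 a ∈ Set.Icc (0 : ℝ) 1) (hπs : Measurable πs) (n : ℕ)
    {a : Ω → Fin K} (ha : Measurable a) :
    Integrable (fun ω => excessLoss πs x ℓ (n + 1) (a ω) ω) μ :=
  (h.integrable_loss_apply hD n ha).sub
    (h.integrable_loss_apply hD n (hπs.comp (h.measurable_x (n + 1))))

lemma integrable_instRegret (h : IsRun μ D Pol ε δ x ℓ act pol)
    (hD : ∀ᵐ z ∂D, ∀ a, z.2 a ∈ Set.Icc (0 : ℝ) 1) (hπs : Measurable πs) (n : ℕ) :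
    Integrable (instRegret πs x ℓ act (n + 1)) μ :=
  h.integrable_excessLoss hD hπs n (h.measurable_act (n + 1))

lemma integral_excessLoss_policy (h : IsRun μ D Pol ε δ x ℓ act pol)
    (hD : ∀ᵐ z ∂D, ∀ a, z.2 a ∈ Set.Icc (0 : ℝ) 1) (hπ : Measurable π) (hπs : Measurable πs)
    (n : ℕ) :
    ∫ ω, excessLoss πs x ℓ (n + 1) (π (x (n + 1) ω)) ω ∂μ = expLoss D π - expLoss D πs := by
  rw [← h.integral_loss_policy hπ n, ← h.integral_loss_policy hπs n]
  exact integral_sub (h.integrable_loss_apply hD n (hπ.comp (h.measurable_x (n + 1))))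
    (h.integrable_loss_apply hD n (hπs.comp (h.measurable_x (n + 1))))

lemma ae_act_mem_exploredAt (h : IsRun μ D Pol ε δ x ℓ act pol) (hε : 0 < ε) (hδ : 0 < δ)
    (hδN : δ ≤ Pol.card) :
    ∀ᵐ ω ∂μ, ∀ n,
      act (n + 1) ω ∈ exploredAt Pol ε δ (x · ω) (ℓ · ω) (act · ω) (pol · ω) (n + 1) := by
  refine ae_all_iff.2 fun n => ?_
  have hzero : ∀ᵐ ω ∂μ, ∀ a,
      (μ[{ω | act (n + 1) ω = a}.indicator (fun _ => (1 : ℝ)) | historyWithExample x ℓ act n]) ω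
        = 0 → {ω | act (n + 1) ω = a}.indicator (fun _ => (1 : ℝ)) ω = 0 :=
    ae_all_iff.2 fun a => ae_eq_zero_of_condExp_eq_zero (h.historyWithExample_le n)
      ((integrable_const 1).indicator (h.measurable_act (n + 1) (measurableSet_singleton a)))
      (Filter.Eventually.of_forall fun ω => Set.indicator_nonneg (fun _ _ => zero_le_one) ω)
  filter_upwards [hzero, ae_all_iff.2 (h.act_law n)] with ω hω hlaw
  by_contra hnot
  have hprob : probAt Pol ε δ (x · ω) (ℓ · ω) (act · ω) (pol · ω) (n + 1) (act (n + 1) ω) = 0 :=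
    actionProb_eq_zero (greedy_mem_exploredAt hε hδ hδN (h.pol_mem n ω)) hnot
  simpa using hω (act (n + 1) ω) ((hlaw _).trans hprob)

lemma condExp_instRegret_eq_sum (h : IsRun μ D Pol ε δ x ℓ act pol)
    (hD : ∀ᵐ z ∂D, ∀ a, z.2 a ∈ Set.Icc (0 : ℝ) 1) (hπs : Measurable πs) (n : ℕ) :
    μ[instRegret πs x ℓ act (n + 1) | historyWithExample x ℓ act n] =ᵐ[μ] fun ω =>
      ∑ a, probAt Pol ε δ (x · ω) (ℓ · ω) (act · ω) (pol · ω) (n + 1) a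
        * excessLoss πs x ℓ (n + 1) a ω := by
  have hexample : Measurable[historyWithExample x ℓ act n]
      fun ω => (x (n + 1) ω, ℓ (n + 1) ω) := measurable_iff_comap_le.2 le_sup_right
  have hmeas : ∀ a, StronglyMeasurable[historyWithExample x ℓ act n]
      (excessLoss πs x ℓ (n + 1) a) := fun a =>
    (measurable_excessLoss (measurable_fst.comp hexample) (measurable_snd.comp hexample) hπs
      measurable_const).stronglyMeasurable
  have hbound : ∀ a, ∀ᵐ ω ∂μ, ‖excessLoss πs x ℓ (n + 1) a ω‖ ≤ 1 := fun a =>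
    (h.ae_abs_excessLoss_le_one hD πs).mono fun ω hω => hω n a
  have haverage := condExp_apply_of_stronglyMeasurable (s := Finset.univ)
    (h.historyWithExample_le n) (fun _ => Finset.mem_univ _)
    (fun a _ => h.measurable_act (n + 1) (measurableSet_singleton a)) (fun a _ => hmeas a)
    fun a _ => hbound a
  filter_upwards [haverage, ae_all_iff.2 (h.act_law n)] with ω hω hlaw
  refine hω.trans (Finset.sum_congr rfl fun a _ => ?_)
  rw [mul_comm, hlaw a]

lemma condExp_instRegret_le_greedy_add (h : IsRun μ D Pol ε δ x ℓ act pol)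
    (hD : ∀ᵐ z ∂D, ∀ a, z.2 a ∈ Set.Icc (0 : ℝ) 1) (hπs : Measurable πs) (hε : 0 < ε)
    (hδ : 0 < δ) (hδN : δ ≤ Pol.card) (n : ℕ) :
    μ[instRegret πs x ℓ act (n + 1) | historyWithExample x ℓ act n] ≤ᵐ[μ] fun ω =>
      excessLoss πs x ℓ (n + 1) (pol (n + 1) ω (x (n + 1) ω)) ω + ε := by
  filter_upwards [h.condExp_instRegret_eq_sum hD hπs n, h.ae_loss_mem_Icc hD] with ω hω hℓ
  rw [hω]
  refine sum_actionProb_mul_le hε.le (greedy_mem_exploredAt hε hδ hδN (h.pol_mem n ω))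
    fun a => ?_
  unfold excessLoss
  linarith [(hℓ n a).2, (hℓ n (pol (n + 1) ω (x (n + 1) ω))).1]

end FiniteMeasure

variable [IsProbabilityMeasure μ]

lemma condExp_excessLoss_policy (h : IsRun μ D Pol ε δ x ℓ act pol)
    (hD : ∀ᵐ z ∂D, ∀ a, z.2 a ∈ Set.Icc (0 : ℝ) 1) (hπ : Measurable π) (hπs : Measurable πs)
    (n : ℕ) :
    μ[fun ω => excessLoss πs x ℓ (n + 1) (π (x (n + 1) ω)) ω | history x ℓ act n] =ᵐ[μ]
      fun _ => expLoss D π - expLoss D πs := by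
  have hexample : Measurable[MeasurableSpace.comap (fun ω => (x (n + 1) ω, ℓ (n + 1) ω))
      inferInstance] fun ω => (x (n + 1) ω, ℓ (n + 1) ω) := comap_measurable _
  have hmeas := measurable_excessLoss (measurable_fst.comp hexample)
    (measurable_snd.comp hexample) hπs (hπ.comp (measurable_fst.comp hexample))
  rw [← h.integral_excessLoss_policy hD hπ hπs n]
  exact condExp_indep_eq (h.measurable_example (n + 1)).comap_le (h.history_le n)
    hmeas.stronglyMeasurable (h.indep n)

lemma condExp_excessLoss_greedy (h : IsRun μ D Pol ε δ x ℓ act pol)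
    (hD : ∀ᵐ z ∂D, ∀ a, z.2 a ∈ Set.Icc (0 : ℝ) 1) (hPol : ∀ π ∈ Pol, Measurable π)
    (hπs : Measurable πs) (n : ℕ) :
    μ[fun ω => excessLoss πs x ℓ (n + 1) (pol (n + 1) ω (x (n + 1) ω)) ω | history x ℓ act n]
      =ᵐ[μ] fun ω => expLoss D (pol (n + 1) ω) - expLoss D πs := by
  have hselect := condExp_apply_of_fibers_measurable
    (F := fun π ω => excessLoss πs x ℓ (n + 1) (π (x (n + 1) ω)) ω)
    (h.history_le n) (h.pol_mem n) (h.pol_past n)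
    fun π hπ => h.integrable_excessLoss hD hπs n ((hPol π hπ).comp (h.measurable_x (n + 1)))
  have hpolicy := (Finset.eventually_all Pol).2 fun π hπ =>
    h.condExp_excessLoss_policy hD (hPol π hπ) hπs n
  filter_upwards [hselect, hpolicy] with ω hω hpolicy
  exact hω.trans (hpolicy _ (h.pol_mem n ω))

lemma condExp_instRegret_le (h : IsRun μ D Pol ε δ x ℓ act pol)
    (hD : ∀ᵐ z ∂D, ∀ a, z.2 a ∈ Set.Icc (0 : ℝ) 1) (hPol : ∀ π ∈ Pol, Measurable π)
    (hπs : Measurable πs) (hε : 0 < ε) (hδ : 0 < δ) (hδN : δ ≤ Pol.card) (n : ℕ) :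
    μ[instRegret πs x ℓ act (n + 1) | history x ℓ act n] ≤ᵐ[μ] fun ω =>
      expLoss D (pol (n + 1) ω) - expLoss D πs + ε := by
  have hgreedy := h.integrable_excessLoss hD hπs n (h.measurable_greedy hPol n)
  have hle := condExp_mono (m := history x ℓ act n) integrable_condExp
    (hgreedy.add (integrable_const ε)) (h.condExp_instRegret_le_greedy_add hD hπs hε hδ hδN n)
  filter_upwards [hle, condExp_condExp_of_le (f := instRegret πs x ℓ act (n + 1))
    le_sup_left (h.historyWithExample_le n), h.condExp_excessLoss_greedy hD hPol hπs n,
    condExp_add hgreedy (integrable_const ε) (history x ℓ act n)] with ω hle htower hω hadd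
  rw [← htower]
  refine hle.trans_eq (hadd.trans ?_)
  rw [Pi.add_apply, hω, condExp_const (h.history_le n)]

lemma ae_act_eq_optimal [IsProbabilityMeasure D] (h : IsRun μ D Pol ε δ x ℓ act pol)
    (hD : ∀ᵐ z ∂D, ∀ a, z.2 a ∈ Set.Icc (0 : ℝ) 1) (hπs : IsOptimal D Pol πs) (hε : 0 < ε)
    (hδ : 0 < δ) (hδN : δ ≤ Pol.card) (hτ : 0 < τ)
    (hgap : ∀ π ∈ Pol, 0 < rho D π πs → τ ≤ expLoss D π - expLoss D πs) :
    ∀ᵐ ω ∂μ, ∀ t, lastRound K Pol.card ε δ τ < t →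
      ω ∈ goodUpTo D Pol πs ε δ x ℓ act pol (t - 1) → act t ω = πs (x t ω) := by
  have hN := Finset.card_ne_zero_of_mem hπs.1
  filter_upwards [h.ae_act_mem_exploredAt hε hδ hδN, h.ae_loss_mem_Icc hD,
    h.ae_eq_optimal_of_rho_eq_zero πs] with ω hexplored hℓ hagree t ht hgood
  have hone := one_le_lastRound (K := K) (ε := ε) hN hδ.ne' hτ
  obtain ⟨n, rfl⟩ := Nat.exists_eq_add_of_le' (Nat.one_le_of_lt ht)
  obtain ⟨π, hπ, hplay, hclose⟩ := exists_policy_of_mem_exploredAt (n := n) hπs hε hδ hδN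
    (fun t a => (hℓ t a).2) (h.pol_argmin · ω) (by omega) hgood (hexplored n)
  have hρ : rho D π πs = 0 := by
    by_contra hne
    have hfar := hgap π hπ (measureReal_nonneg.lt_of_ne' hne)
    linarith [two_mul_threshold_lt hN hδ.ne' hτ ht]
  rw [← hplay, hagree n π hπ hρ]

lemma ae_instRegret_eq_zero [IsProbabilityMeasure D] (h : IsRun μ D Pol ε δ x ℓ act pol)
    (hD : ∀ᵐ z ∂D, ∀ a, z.2 a ∈ Set.Icc (0 : ℝ) 1) (hπs : IsOptimal D Pol πs) (hε : 0 < ε)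
    (hδ : 0 < δ) (hδN : δ ≤ Pol.card) (hτ : 0 < τ)
    (hgap : ∀ π ∈ Pol, 0 < rho D π πs → τ ≤ expLoss D π - expLoss D πs) :
    ∀ᵐ ω ∂μ, ∀ t, lastRound K Pol.card ε δ τ < t →
      ω ∈ goodUpTo D Pol πs ε δ x ℓ act pol (t - 1) → instRegret πs x ℓ act t ω = 0 := by
  filter_upwards [h.ae_act_eq_optimal hD hπs hε hδ hδN hτ hgap] with ω hω t ht hgood
  rw [instRegret, hω t ht hgood, sub_self]

lemma ae_condExp_instRegret_eq_zero [IsProbabilityMeasure D] (h : IsRun μ D Pol ε δ x ℓ act pol)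
    (hD : ∀ᵐ z ∂D, ∀ a, z.2 a ∈ Set.Icc (0 : ℝ) 1) (hPol : ∀ π ∈ Pol, Measurable π)
    (hπs : IsOptimal D Pol πs) (hε : 0 < ε) (hδ : 0 < δ) (hδN : δ ≤ Pol.card) (hτ : 0 < τ)
    (hgap : ∀ π ∈ Pol, 0 < rho D π πs → τ ≤ expLoss D π - expLoss D πs) :
    ∀ᵐ ω ∂μ, ∀ t, lastRound K Pol.card ε δ τ < t →
      ω ∈ goodUpTo D Pol πs ε δ x ℓ act pol (t - 1) →
        (μ[instRegret πs x ℓ act t | history x ℓ act (t - 1)]) ω = 0 := by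
  refine ae_all_iff.2 fun t => ?_
  by_cases ht : lastRound K Pol.card ε δ τ < t
  · have hgood := h.measurableSet_goodUpTo hPol hπs.1 (t - 1)
    have hzero : instRegret πs x ℓ act t
        =ᵐ[μ.restrict (goodUpTo D Pol πs ε δ x ℓ act pol (t - 1))] 0 :=
      (ae_restrict_iff' (h.history_le _ _ hgood)).2 <|
        (h.ae_instRegret_eq_zero hD hπs hε hδ hδN hτ hgap).mono fun ω hω => hω t ht
    filter_upwards [(ae_restrict_iff' (h.history_le _ _ hgood)).1
      (condExp_ae_eq_restrict_zero hgood hzero)] with ω hω _ using hω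
  · exact Filter.Eventually.of_forall fun ω ht' => absurd ht' ht

lemma ae_condExp_instRegret_le_roundBound [IsProbabilityMeasure D]
    (h : IsRun μ D Pol ε δ x ℓ act pol)
    (hD : ∀ᵐ z ∂D, ∀ a, z.2 a ∈ Set.Icc (0 : ℝ) 1) (hPol : ∀ π ∈ Pol, Measurable π)
    (hπs : IsOptimal D Pol πs) (hε : 0 < ε) (hδ : 0 < δ) (hδN : δ ≤ Pol.card) :
    ∀ᵐ ω ∂μ, ∀ t, 1 ≤ t → ω ∈ goodUpTo D Pol πs ε δ x ℓ act pol (t - 1) →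
      (μ[instRegret πs x ℓ act t | history x ℓ act (t - 1)]) ω ≤ roundBound K Pol.card ε δ t := by
  have hπs_meas := hPol πs hπs.1
  have hfirst : μ[instRegret πs x ℓ act 1 | history x ℓ act 0] ≤ᵐ[μ] fun _ => (1 : ℝ) := by
    refine (condExp_mono (h.integrable_instRegret hD hπs_meas 0) (integrable_const 1) ?_).trans_eq
      (condExp_const (h.history_le 0) 1).eventuallyEq
    filter_upwards [h.ae_abs_excessLoss_le_one hD πs] with ω hω using (abs_le.1 (hω 0 _)).2
  have hlater := ae_all_iff.2 fun n => h.condExp_instRegret_le hD hPol hπs_meas hε hδ hδN n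
  filter_upwards [hfirst, hlater, h.ae_loss_mem_Icc hD] with ω hfirst hlater hℓ t ht hgood
  obtain rfl | ht := ht.eq_or_lt
  · simpa only [roundBound, if_pos] using hfirst
  · obtain ⟨n, rfl⟩ := Nat.exists_eq_add_of_le' ht.le
    rw [roundBound, if_neg ht.ne']
    refine (hlater n).trans (add_le_add_left ?_ ε)
    exact expLoss_greedy_sub_le hπs hε hδ hδN (fun t a => (hℓ t a).2) (h.pol_argmin · ω)
      (Nat.lt_add_one_iff.1 ht) hgood

lemma ae_sum_condExp_instRegret_le [IsProbabilityMeasure D] (h : IsRun μ D Pol ε δ x ℓ act pol)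
    (hD : ∀ᵐ z ∂D, ∀ a, z.2 a ∈ Set.Icc (0 : ℝ) 1) (hPol : ∀ π ∈ Pol, Measurable π)
    (hπs : IsOptimal D Pol πs) (hε : 0 < ε) (hδ : 0 < δ) (hδN : δ ≤ Pol.card) (hτ : 0 < τ)
    (hgap : ∀ π ∈ Pol, 0 < rho D π πs → τ ≤ expLoss D π - expLoss D πs) :
    ∀ᵐ ω ∂μ, ω ∈ goodEvent D Pol πs ε δ x ℓ act pol → ∀ T,
      ∑ t ∈ Finset.Icc 1 T, (μ[instRegret πs x ℓ act t | history x ℓ act (t - 1)]) ω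
        ≤ regretBound K Pol.card ε δ τ := by
  filter_upwards [h.ae_condExp_instRegret_le_roundBound hD hPol hπs hε hδ hδN,
    h.ae_condExp_instRegret_eq_zero hD hPol hπs hε hδ hδN hτ hgap] with ω hle hzero hω T
  exact sum_le_regretBound hε hδ hδN hτ
    (fun t ht => hle t ht (goodEvent_subset_goodUpTo _ hω))
    (fun t ht => (hzero t ht (goodEvent_subset_goodUpTo _ hω)).le) T

lemma integrable_regret (h : IsRun μ D Pol ε δ x ℓ act pol)
    (hD : ∀ᵐ z ∂D, ∀ a, z.2 a ∈ Set.Icc (0 : ℝ) 1) (hπs : Measurable πs) (T : ℕ) :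
    Integrable (regret πs x ℓ act T) μ := by
  refine integrable_finsetSum _ fun t ht => ?_
  obtain ⟨n, rfl⟩ := Nat.exists_eq_add_of_le' (Finset.mem_Icc.1 ht).1
  exact h.integrable_instRegret hD hπs n

lemma integrable_indicator_instRegret (h : IsRun μ D Pol ε δ x ℓ act pol)
    (hD : ∀ᵐ z ∂D, ∀ a, z.2 a ∈ Set.Icc (0 : ℝ) 1) (hPol : ∀ π ∈ Pol, Measurable π)
    (hπs : πs ∈ Pol) {t : ℕ} (ht : 1 ≤ t) :
    Integrable ((goodUpTo D Pol πs ε δ x ℓ act pol (t - 1)).indicator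
      (instRegret πs x ℓ act t)) μ := by
  obtain ⟨n, rfl⟩ := Nat.exists_eq_add_of_le' ht
  exact (h.integrable_instRegret hD (hPol πs hπs) n).indicator
    (h.history_le n _ (h.measurableSet_goodUpTo hPol hπs n))

lemma integrable_stoppedRegret (h : IsRun μ D Pol ε δ x ℓ act pol)
    (hD : ∀ᵐ z ∂D, ∀ a, z.2 a ∈ Set.Icc (0 : ℝ) 1) (hPol : ∀ π ∈ Pol, Measurable π)
    (hπs : πs ∈ Pol) (T : ℕ) : Integrable (stoppedRegret D Pol πs ε δ x ℓ act pol T) μ :=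
  integrable_finsetSum _ fun _ ht =>
    h.integrable_indicator_instRegret hD hPol hπs (Finset.mem_Icc.1 ht).1

lemma integral_stoppedRegret_le [IsProbabilityMeasure D] (h : IsRun μ D Pol ε δ x ℓ act pol)
    (hD : ∀ᵐ z ∂D, ∀ a, z.2 a ∈ Set.Icc (0 : ℝ) 1) (hPol : ∀ π ∈ Pol, Measurable π)
    (hπs : IsOptimal D Pol πs) (hε : 0 < ε) (hδ : 0 < δ) (hδN : δ ≤ Pol.card) (hτ : 0 < τ)
    (hgap : ∀ π ∈ Pol, 0 < rho D π πs → τ ≤ expLoss D π - expLoss D πs) (T : ℕ) :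
    ∫ ω, stoppedRegret D Pol πs ε δ x ℓ act pol T ω ∂μ ≤ regretBound K Pol.card ε δ τ := by
  have hle : ∀ t, 1 ≤ t → ∫ ω, (goodUpTo D Pol πs ε δ x ℓ act pol (t - 1)).indicator
      (instRegret πs x ℓ act t) ω ∂μ ≤ roundBound K Pol.card ε δ t := fun t ht => by
    obtain ⟨n, rfl⟩ := Nat.exists_eq_add_of_le' ht
    refine integral_indicator_le_of_condExp_le (h.history_le n)
      (h.integrable_instRegret hD (hPol πs hπs.1) n) (h.measurableSet_goodUpTo hPol hπs.1 n)
      (roundBound_nonneg hε hδ hδN (n + 1)) ?_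
    filter_upwards [h.ae_condExp_instRegret_le_roundBound hD hPol hπs hε hδ hδN] with ω hω
      using hω (n + 1) ht
  have hlate : ∀ t, lastRound K Pol.card ε δ τ < t →
      ∫ ω, (goodUpTo D Pol πs ε δ x ℓ act pol (t - 1)).indicator
        (instRegret πs x ℓ act t) ω ∂μ ≤ 0 := fun t ht => by
    refine (integral_eq_zero_of_ae ?_).le
    filter_upwards [h.ae_instRegret_eq_zero hD hπs hε hδ hδN hτ hgap] with ω hω
      using Set.indicator_apply_eq_zero.2 (hω t ht)
  have hsum := integral_finsetSum (Finset.Icc 1 T) fun t ht =>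
    h.integrable_indicator_instRegret hD hPol hπs.1 (Finset.mem_Icc.1 ht).1
  exact hsum.trans_le (sum_le_regretBound hε hδ hδN hτ hle hlate T)

lemma ae_abs_stoppedRegret_le [IsProbabilityMeasure D] (h : IsRun μ D Pol ε δ x ℓ act pol)
    (hD : ∀ᵐ z ∂D, ∀ a, z.2 a ∈ Set.Icc (0 : ℝ) 1) (hπs : IsOptimal D Pol πs) (hε : 0 < ε)
    (hδ : 0 < δ) (hδN : δ ≤ Pol.card) (hτ : 0 < τ)
    (hgap : ∀ π ∈ Pol, 0 < rho D π πs → τ ≤ expLoss D π - expLoss D πs) (T : ℕ) :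
    ∀ᵐ ω ∂μ, |stoppedRegret D Pol πs ε δ x ℓ act pol T ω| ≤ lastRound K Pol.card ε δ τ := by
  filter_upwards [h.ae_instRegret_eq_zero hD hπs hε hδ hδN hτ hgap,
    h.ae_abs_excessLoss_le_one hD πs] with ω hzero hbound
  have hone : ∀ t ∈ Finset.Icc 1 T, |(goodUpTo D Pol πs ε δ x ℓ act pol (t - 1)).indicator
      (instRegret πs x ℓ act t) ω| ≤ 1 := fun t ht => by
    obtain ⟨n, rfl⟩ := Nat.exists_eq_add_of_le' (Finset.mem_Icc.1 ht).1
    exact (norm_indicator_le_norm_self (instRegret πs x ℓ act (n + 1)) ω).trans (hbound n _)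
  calc |stoppedRegret D Pol πs ε δ x ℓ act pol T ω|
      ≤ ∑ t ∈ Finset.Icc 1 T, |(goodUpTo D Pol πs ε δ x ℓ act pol (t - 1)).indicator
          (instRegret πs x ℓ act t) ω| := Finset.abs_sum_le_sum_abs _ _
    _ ≤ ∑ _t ∈ Finset.Icc 1 (lastRound K Pol.card ε δ τ), (1 : ℝ) := by
        refine sum_le_sum_of_le_of_nonpos (fun t ht _ => hone t ht) (fun t ht hnot => ?_)
          fun _ _ => zero_le_one
        rw [Finset.mem_Icc] at ht hnot
        rw [Set.indicator_apply_eq_zero.2 (hzero t (by omega)), abs_zero]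
    _ = lastRound K Pol.card ε δ τ := by simp

lemma integral_regret_cond_le_lastRound [IsProbabilityMeasure D] (h : IsRun μ D Pol ε δ x ℓ act pol)
    (hD : ∀ᵐ z ∂D, ∀ a, z.2 a ∈ Set.Icc (0 : ℝ) 1) (hPol : ∀ π ∈ Pol, Measurable π)
    (hπs : IsOptimal D Pol πs) (hε : 0 < ε) (hδ : 0 < δ) (hδN : δ ≤ Pol.card) (hτ : 0 < τ)
    (hgap : ∀ π ∈ Pol, 0 < rho D π πs → τ ≤ expLoss D π - expLoss D πs) (T : ℕ) :
    ∫ ω, regret πs x ℓ act T ω ∂μ[|goodEvent D Pol πs ε δ x ℓ act pol]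
      ≤ lastRound K Pol.card ε δ τ := by
  rw [h.integral_regret_cond_eq hPol hπs.1]
  exact integral_cond_le (h.integrable_stoppedRegret hD hPol hπs.1 T) (Nat.cast_nonneg _)
    ((h.ae_abs_stoppedRegret_le hD hπs hε hδ hδN hτ hgap T).mono fun _ hω => (abs_le.1 hω).2) _

lemma integral_regret_cond_le [IsProbabilityMeasure D] (h : IsRun μ D Pol ε δ x ℓ act pol)
    (hD : ∀ᵐ z ∂D, ∀ a, z.2 a ∈ Set.Icc (0 : ℝ) 1) (hPol : ∀ π ∈ Pol, Measurable π)
    (hπs : IsOptimal D Pol πs) (hε : 0 < ε) (hδ : 0 < δ) (hδN : δ ≤ Pol.card) (hτ : 0 < τ)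
    (hgap : ∀ π ∈ Pol, 0 < rho D π πs → τ ≤ expLoss D π - expLoss D πs) (T : ℕ) :
    ∫ ω, regret πs x ℓ act T ω ∂μ[|goodEvent D Pol πs ε δ x ℓ act pol]
      ≤ regretBound K Pol.card ε δ τ
        + (regretBound K Pol.card ε δ τ + lastRound K Pol.card ε δ τ)
          * (μ.real (goodEvent D Pol πs ε δ x ℓ act pol)ᶜ
            / μ.real (goodEvent D Pol πs ε δ x ℓ act pol)) := by
  rw [h.integral_regret_cond_eq hPol hπs.1]
  exact integral_cond_le_of_neg_le (h.integrable_stoppedRegret hD hPol hπs.1 T)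
    (regretBound_nonneg hε hδ hδN)
    (h.integral_stoppedRegret_le hD hPol hπs hε hδ hδN hτ hgap T)
    ((h.ae_abs_stoppedRegret_le hD hπs hε hδ hδN hτ hgap T).mono fun _ hω => (abs_le.1 hω).1)
    (h.measurableSet_goodEvent hPol hπs.1)

end IsRun

end ActiveGreedy

open ActiveGreedy in
theorem mainTheorem5_general {X Ω : Type*} [MeasurableSpace X] [MeasurableSpace Ω] {K : ℕ}
    (μ : Measure Ω) [IsProbabilityMeasure μ]
    (D : Measure (X × (Fin K → ℝ))) [IsProbabilityMeasure D]
    (hD : ∀ᵐ z ∂D, ∀ a, z.2 a ∈ Set.Icc (0 : ℝ) 1)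
    (Pol : Finset (Policy X K)) (hPol : ∀ π ∈ Pol, Measurable π)
    (πs : Policy X K) (hπs : IsOptimal D Pol πs)
    (ε δ τ : ℝ) (hε : 0 < ε) (hδ : 0 < δ) (hδN : δ ≤ Pol.card) (hτ : 0 < τ)
    (hgap : ∀ π ∈ Pol, 0 < rho D π πs → τ ≤ expLoss D π - expLoss D πs)
    (x : ℕ → Ω → X) (ℓ : ℕ → Ω → Fin K → ℝ) (act : ℕ → Ω → Fin K) (pol : ℕ → Ω → Policy X K)
    (hrun : IsRun μ D Pol ε δ x ℓ act pol) :
    let E : Set Ω := goodEvent D Pol πs ε δ x ℓ act pol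
    let T₀ : ℕ := lastRound K Pol.card ε δ τ
    let B : ℝ := regretBound K Pol.card ε δ τ
    IsGreatest (unresolvedRounds K Pol.card ε δ τ) T₀ ∧
    (∀ᵐ ω ∂μ, ω ∈ E → ∀ t, T₀ < t →
      act t ω = πs (x t ω) ∧ instRegret πs x ℓ act t ω = 0) ∧
    (∀ᵐ ω ∂μ, ω ∈ E → ∀ t, T₀ < t →
      (μ[instRegret πs x ℓ act t | history x ℓ act (t - 1)]) ω = 0) ∧
    (∀ᵐ ω ∂μ, ω ∈ E → ∀ T : ℕ,
      ∑ t ∈ Finset.Icc 1 T, (μ[instRegret πs x ℓ act t | history x ℓ act (t - 1)]) ω ≤ B) ∧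
    (∀ T : ℕ, Integrable (regret πs x ℓ act T) μ ∧
      ∫ ω, ∑ t ∈ Finset.Icc 1 T,
        (goodUpTo D Pol πs ε δ x ℓ act pol (t - 1)).indicator (instRegret πs x ℓ act t) ω ∂μ
          ≤ B) ∧
    (∀ T : ℕ, ∫ ω, regret πs x ℓ act T ω ∂(μ[|E]) ≤ T₀ ∧
      ∫ ω, regret πs x ℓ act T ω ∂(μ[|E]) ≤ B + (B + T₀) * (μ.real Eᶜ / μ.real E)) := by
  intro E T₀ B
  refine ⟨isGreatest_lastRound (Finset.card_ne_zero_of_mem hπs.1) hδ.ne' hτ, ?_, ?_,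
    hrun.ae_sum_condExp_instRegret_le hD hPol hπs hε hδ hδN hτ hgap,
    fun T => ⟨hrun.integrable_regret hD (hPol πs hπs.1) T,
      hrun.integral_stoppedRegret_le hD hPol hπs hε hδ hδN hτ hgap T⟩,
    fun T => ⟨hrun.integral_regret_cond_le_lastRound hD hPol hπs hε hδ hδN hτ hgap T,
      hrun.integral_regret_cond_le hD hPol hπs hε hδ hδN hτ hgap T⟩⟩
  · filter_upwards [hrun.ae_act_eq_optimal hD hπs hε hδ hδN hτ hgap,
      hrun.ae_instRegret_eq_zero hD hπs hε hδ hδN hτ hgap] with ω hact hregret hω t ht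
    have hgood := goodEvent_subset_goodUpTo (t - 1) hω
    exact ⟨hact t ht hgood, hregret t ht hgood⟩
  · filter_upwards [hrun.ae_condExp_instRegret_eq_zero hD hPol hπs hε hδ hδN hτ hgap]
      with ω hregret hω t ht
    exact hregret t ht (goodEvent_subset_goodUpTo _ hω)

open ActiveGreedy in
theorem mainTheorem5 {X Ω : Type*} [MeasurableSpace X] [MeasurableSpace Ω] {K : ℕ}
    (μ : Measure Ω) [IsProbabilityMeasure μ]
    (D : Measure (X × (Fin K → ℝ))) [IsProbabilityMeasure D]
    (hD : ∀ᵐ z ∂D, ∀ a, z.2 a ∈ Set.Icc (0 : ℝ) 1)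
    (Pol : Finset (Policy X K)) (hPol : ∀ π ∈ Pol, Measurable π)
    (πs : Policy X K) (hπs : IsOptimal D Pol πs)
    (ε δ τ : ℝ) (hε : 0 < ε) (hε1 : ε ≤ 1) (hδ : 0 < δ) (hδ1 : δ < 1) (hτ : 0 < τ)
    (hgap : ∀ π ∈ Pol, π ≠ πs → τ ≤ expLoss D π - expLoss D πs)
    (hθ : disCoeff D Pol πs < ⊤)
    (x : ℕ → Ω → X) (ℓ : ℕ → Ω → Fin K → ℝ) (act : ℕ → Ω → Fin K) (pol : ℕ → Ω → Policy X K)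
    (hrun : IsRun μ D Pol ε δ x ℓ act pol) :
    -- abbreviations: the event `E`, the round `T_0`, the constant `B = 1 + ∑_{t=2}^{T_0} (Δ_t + ε)`
    let E : Set Ω := goodEvent D Pol πs ε δ x ℓ act pol
    let T₀ : ℕ := lastRound K Pol.card ε δ τ
    let B : ℝ := regretBound K Pol.card ε δ τ
    -- `T_0` is a genuine maximum
    IsGreatest (unresolvedRounds K Pol.card ε δ τ) T₀ ∧
    -- on `E`, the optimal action is played, and no regret is incurred, in every round after `T_0`
    (∀ᵐ ω ∂μ, ω ∈ E → ∀ t, T₀ < t →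
      act t ω = πs (x t ω) ∧ instRegret πs x ℓ act t ω = 0) ∧
    -- the same for the expected regret of the round given the past
    (∀ᵐ ω ∂μ, ω ∈ E → ∀ t, T₀ < t →
      (μ[instRegret πs x ℓ act t | history x ℓ act (t - 1)]) ω = 0) ∧
    -- on `E`, the expected regret, summed over the rounds, is at most `B`, for every horizon
    (∀ᵐ ω ∂μ, ω ∈ E → ∀ T : ℕ,
      ∑ t ∈ Finset.Icc 1 T, (μ[instRegret πs x ℓ act t | history x ℓ act (t - 1)]) ω ≤ B) ∧
    -- the regret has an expectation, and the expected regret incurred as long as the bounds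
    -- that define `E` have not failed is at most `B`
    (∀ T : ℕ, Integrable (regret πs x ℓ act T) μ ∧
      ∫ ω, ∑ t ∈ Finset.Icc 1 T,
        (goodUpTo D Pol πs ε δ x ℓ act pol (t - 1)).indicator (instRegret πs x ℓ act t) ω ∂μ
          ≤ B) ∧
    -- conditionally on `E`, the expected regret is bounded by a constant independent of the horizon
    (∀ T : ℕ, ∫ ω, regret πs x ℓ act T ω ∂(μ[|E]) ≤ T₀ ∧
      ∫ ω, regret πs x ℓ act T ω ∂(μ[|E]) ≤ B + (B + T₀) * (μ.real Eᶜ / μ.real E)) := by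
  exact mainTheorem5_general μ D hD Pol hPol πs hπs ε δ τ hε hδ
    (hδ1.le.trans (Nat.one_le_cast.2 (Finset.card_pos.2 ⟨πs, hπs.1⟩))) hτ
    (fun π hπ hρ => hgap π hπ fun h => by simp [h, rho] at hρ) x ℓ act pol hrun
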